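/- Let $(X,\Sigma)$ be a measurable space and let $p(x,E)$ ($x\in X$, $E\in\Sigma$) be the transition function of a Markov chain: $p(x,\cdot)$ is a countably additive probability measure for every $x$, and $p(\cdot,E)$ is measurable for every $E$. Let $B(X,\Sigma)$ be the space of bounded measurable functions $X\to\mathbb R$, let $ba(X,\Sigma)$ and $ca(X,\Sigma)$ be the spaces of bounded finitely additive and bounded countably additive real-valued measures on $\Sigma$, and let $S_{ba}=\{\mu\in ba(X,\Sigma):\mu\ge 0,\ \mu(X)=1\}$. Let $A$ be the Markov operator $A\mu(E)=\int_X p(x,E)\,\mu(dx)$ on $ba(X,\Sigma)$, and let $\Delta_{ba}=\{\mu\in S_{ba}:A\mu=\mu\}$ be the set of invariant finitely additive probability measures. Let $\tau_B$ be the weak* topology on $ba(X,\Sigma)$, generated by the functionals $\mu\mapsto\int f\,d\mu$ with $f\in B(X,\Sigma)$. A cycle is a family of pairwise distinct measures $\nu_1,\dots,\nu_n\in S_{ba}$, $n\ge 2$, with $A\nu_i=\nu_{i+1}$ for $1\le i<n$ and $A\nu_n=\nu_1$. An invariant measure $\mu\in\Delta_{ba}$ is called simple if it is not of the form $\frac1n\sum_{i=1}^n\nu_i$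 for any cycle $\nu_1,\dots,\nu_n$. **Theorem.** Suppose that the chain has a unique invariant finitely additive probability measure $\mu$, i.e. $\Delta_{ba}=\{\mu\}$. Then: 1. $(*)$ holds: $\Delta_{ba}\subset ca(X,\Sigma)$, i.e. $\mu$ is countably additive. 2. For every $\eta\in S_{ba}$ the Cesàro averages $\lambda_n^\eta=\frac1n\sum_{k=1}^n A^k\eta$ converge to $\mu$ in the topology $\tau_B$, and $\lim_{n\to\infty}\lambda_n^\eta(E)=\mu(E)$ for all $E\in\Sigma$. 3. If $\mu$ is simple, then for every $\eta\in S_{ba}$ the sequence $A^n\eta$ itself converges to $\mu$ in the topology $\tau_B$, and $\lim_{n\to\infty}A^n\eta(E)=\mu(E)$ for all $E\in\Sigma$. -/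

import Mathlib

open MeasureTheory Filter Topology

namespace FAMarkov

/-- The σ-algebra `Σ` of the measurable space `X`, as a type. -/
abbrev MSet (X : Type*) [MeasurableSpace X] : Type _ := {E : Set X // MeasurableSet E}

/-- Real-valued set functions on `Σ`. -/
abbrev SetFun (X : Type*) [MeasurableSpace X] : Type _ := MSet X → ℝ

/-- `ba(X, Σ)`: bounded finitely additive (signed) measures on `Σ`. -/
def ba (X : Type*) [MeasurableSpace X] : Set (SetFun X) :=
  {μ | μ ⟨∅, MeasurableSet.empty⟩ = 0 ∧
    (∀ E F : MSet X, Disjoint (E : Set X) (F : Set X) →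
      μ ⟨(E : Set X) ∪ (F : Set X), E.2.union F.2⟩ = μ E + μ F) ∧
    ∃ C : ℝ, ∀ E : MSet X, |μ E| ≤ C}

/-- `ca(X, Σ)`: bounded countably additive (signed) measures on `Σ`. -/
def ca (X : Type*) [MeasurableSpace X] : Set (SetFun X) :=
  {μ | μ ∈ ba X ∧
    ∀ E : ℕ → MSet X, Pairwise (fun i j => Disjoint (E i : Set X) (E j : Set X)) →
      HasSum (fun n => μ (E n)) (μ ⟨⋃ n, (E n : Set X), MeasurableSet.iUnion fun n => (E n).2⟩)}

/-- `S_ba`: finitely additive probability measures. For `μ ≥ 0` the total variation norm of `μ`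
is `μ(X)`, so that the normalization `‖μ‖ = 1` reads `μ(X) = 1`. -/
def Sba (X : Type*) [MeasurableSpace X] : Set (SetFun X) :=
  {μ | μ ∈ ba X ∧ (∀ E : MSet X, 0 ≤ μ E) ∧ μ ⟨Set.univ, MeasurableSet.univ⟩ = 1}

/-- `B(X, Σ)`: bounded measurable real functions. -/
abbrev BFun (X : Type*) [MeasurableSpace X] : Type _ :=
  {f : X → ℝ // Measurable f ∧ ∃ C : ℝ, ∀ x, |f x| ≤ C}

/-- The integral of a simple function, `∑ y, y * μ(g = y)`. -/
noncomputable def simpleIntegral {X : Type*} [MeasurableSpace X]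
    (μ : SetFun X) (g : SimpleFunc X ℝ) : ℝ :=
  ∑ y ∈ g.range, y * μ ⟨g ⁻¹' {y}, g.measurableSet_fiber y⟩

/-- `I` is the integral of `f` against `μ`: the limit of the integrals of simple functions
that converge to `f` uniformly, whatever these simple functions are. -/
def HasFAIntegral {X : Type*} [MeasurableSpace X] (μ : SetFun X) (f : X → ℝ) (I : ℝ) : Prop :=
  ∀ g : ℕ → SimpleFunc X ℝ, TendstoUniformly (fun n x => g n x) f atTop →
    Tendsto (fun n => simpleIntegral μ (g n)) atTop (𝓝 I)

/-- The integral `∫ f dμ`; for `μ ∈ ba(X, Σ)` and `f ∈ B(X, Σ)` it is the unique number `I` with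
`HasFAIntegral μ f I`, see `existsUnique_hasFAIntegral`. -/
noncomputable def faIntegral {X : Type*} [MeasurableSpace X] (μ : SetFun X) (f : X → ℝ) : ℝ :=
  Classical.epsilon (HasFAIntegral μ f)

theorem sum_fiber {X : Type*} [MeasurableSpace X] {μ : SetFun X}
    (hμ : μ ∈ ba X) (g : SimpleFunc X ℝ) (s : Finset ℝ) :
    ∑ y ∈ s, μ ⟨g ⁻¹' {y}, g.measurableSet_fiber y⟩ =
      μ ⟨g ⁻¹' (s : Set ℝ), g.measurableSet_preimage _⟩ := by
  classical
  induction s using Finset.induction_on with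
  | empty => simpa using hμ.1.symm
  | insert a s ha ih =>
    rw [Finset.sum_insert ha, ih, ← hμ.2.1 ⟨_, g.measurableSet_fiber a⟩
      ⟨_, g.measurableSet_preimage (s : Set ℝ)⟩]
    · congr 2
      ext x
      simp
    · rw [Set.disjoint_left]
      intro x hx hx'
      simp only [Set.mem_preimage, Set.mem_singleton_iff, Finset.mem_coe] at hx hx'
      exact ha (hx ▸ hx')

theorem sum_abs_fiber_le {X : Type*} [MeasurableSpace X] {μ : SetFun X}
    (hμ : μ ∈ ba X) {C : ℝ} (hC : ∀ E : MSet X, |μ E| ≤ C) (g : SimpleFunc X ℝ) (s : Finset ℝ) :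
    ∑ y ∈ s, |μ ⟨g ⁻¹' {y}, g.measurableSet_fiber y⟩| ≤ 2 * C := by
  classical
  rw [← Finset.sum_filter_add_sum_filter_not s
    (fun y => 0 ≤ μ ⟨g ⁻¹' {y}, g.measurableSet_fiber y⟩)]
  rw [Finset.sum_congr rfl (fun y hy => abs_of_nonneg (Finset.mem_filter.1 hy).2),
    Finset.sum_congr (s₁ := s.filter (fun y => ¬ 0 ≤ μ ⟨g ⁻¹' {y}, g.measurableSet_fiber y⟩)) rfl
      (fun y hy => abs_of_neg (not_le.1 (Finset.mem_filter.1 hy).2)),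
    Finset.sum_neg_distrib, sum_fiber hμ, sum_fiber hμ, two_mul]
  exact add_le_add ((le_abs_self _).trans (hC _)) ((neg_le_abs _).trans (hC _))

theorem simpleIntegral_sub {X : Type*} [MeasurableSpace X] {μ : SetFun X}
    (hμ : μ ∈ ba X) (g h : SimpleFunc X ℝ) :
    simpleIntegral μ (g - h) = simpleIntegral μ g - simpleIntegral μ h := by
  classical
  let T : Set X → ℝ →L[ℝ] ℝ := fun s =>
    (if hs : MeasurableSet s then μ ⟨s, hs⟩ else 0) • ContinuousLinearMap.id ℝ ℝ
  have hT : FinMeasAdditive (0 : Measure X) T := by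
    intro s t hs ht _ _ hst
    simp only [T, hs, ht, hs.union ht, dif_pos, ← add_smul]
    rw [hμ.2.1 ⟨s, hs⟩ ⟨t, ht⟩ hst]
  have key : ∀ g : SimpleFunc X ℝ, simpleIntegral μ g = g.setToSimpleFunc T := by
    intro g
    refine Finset.sum_congr rfl fun y _ => ?_
    simp [T, g.measurableSet_fiber y, mul_comm]
  rw [key, key, key]
  exact SimpleFunc.setToSimpleFunc_sub T hT (by simp) (by simp)

theorem abs_simpleIntegral_sub_le {X : Type*} [MeasurableSpace X] {μ : SetFun X}
    (hμ : μ ∈ ba X) {C : ℝ} (hC : ∀ E : MSet X, |μ E| ≤ C) (g h : SimpleFunc X ℝ) {δ : ℝ}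
    (h0 : 0 ≤ δ) (hδ : ∀ x, |g x - h x| ≤ δ) :
    |simpleIntegral μ g - simpleIntegral μ h| ≤ δ * (2 * C) := by
  rw [← simpleIntegral_sub hμ]
  refine (Finset.abs_sum_le_sum_abs _ _).trans ?_
  refine le_trans (Finset.sum_le_sum (g := fun y =>
    δ * |μ ⟨(g - h) ⁻¹' {y}, (g - h).measurableSet_fiber y⟩|) fun y hy => ?_) ?_
  · rw [abs_mul]
    obtain ⟨x, rfl⟩ := SimpleFunc.mem_range.1 hy
    exact mul_le_mul_of_nonneg_right (hδ x) (abs_nonneg _)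
  · rw [← Finset.mul_sum]
    exact mul_le_mul_of_nonneg_left (sum_abs_fiber_le hμ hC _ _) h0

theorem exists_tendstoUniformly {X : Type*} [MeasurableSpace X] (f : BFun X) :
    ∃ g : ℕ → SimpleFunc X ℝ, TendstoUniformly (fun n x => g n x) f.1 atTop := by
  obtain ⟨f, hf, C, hC⟩ := f
  refine ⟨fun n => ⟨fun x => (⌊f x * (n + 1)⌋ : ℝ) / (n + 1), fun y => ?_, ?_⟩, ?_⟩
  · have : Measurable fun x => (⌊f x * (n + 1)⌋ : ℝ) / (n + 1) :=
      (measurable_from_top.comp (Int.measurable_floor.comp (hf.mul_const _))).div_const _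
    exact this (measurableSet_singleton y)
  · refine ((Set.finite_Icc ⌊-C * (n + 1)⌋ ⌊C * (n + 1)⌋).image
      (fun k : ℤ => (k : ℝ) / (n + 1))).subset ?_
    rintro _ ⟨x, rfl⟩
    have h := abs_le.1 (hC x)
    refine ⟨⌊f x * (n + 1)⌋, ⟨?_, ?_⟩, rfl⟩ <;> apply Int.floor_mono <;>
      apply mul_le_mul_of_nonneg_right _ (by positivity)
    exacts [h.1, h.2]
  · rw [Metric.tendstoUniformly_iff]
    intro ε hε
    filter_upwards [tendsto_one_div_add_atTop_nhds_zero_nat.eventually (gt_mem_nhds hε)] with n hn x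
    refine lt_of_le_of_lt ?_ hn
    have hp : (0 : ℝ) < n + 1 := by positivity
    change |f x - (⌊f x * (n + 1)⌋ : ℝ) / (n + 1)| ≤ 1 / (n + 1)
    have h1 := Int.floor_le (f x * (n + 1))
    have h2 := Int.lt_floor_add_one (f x * (n + 1))
    have : f x - (⌊f x * (n + 1)⌋ : ℝ) / (n + 1) = (f x * (n + 1) - ⌊f x * (n + 1)⌋) / (n + 1) := by
      field_simp
    rw [this, abs_of_nonneg (div_nonneg (by linarith) hp.le)]
    exact div_le_div_of_nonneg_right (by linarith) hp.le

/-- Existence and uniqueness of the integral of `f ∈ B(X, Σ)` against `μ ∈ ba(X, Σ)`. -/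
theorem existsUnique_hasFAIntegral {X : Type*} [MeasurableSpace X] {μ : SetFun X}
    (hμ : μ ∈ ba X) (f : BFun X) : ∃! I : ℝ, HasFAIntegral μ f.1 I := by
  obtain ⟨C, hC⟩ := hμ.2.2
  have hC0 : 0 ≤ C := (abs_nonneg _).trans (hC ⟨∅, MeasurableSet.empty⟩)
  have close : ∀ g h : ℕ → SimpleFunc X ℝ, TendstoUniformly (fun n x => g n x) f.1 atTop →
      TendstoUniformly (fun n x => h n x) f.1 atTop → ∀ ε > 0, ∃ N, ∀ m ≥ N, ∀ n ≥ N,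
        |simpleIntegral μ (g m) - simpleIntegral μ (h n)| < ε := by
    intro g h hg hh ε hε
    rw [Metric.tendstoUniformly_iff] at hg hh
    have hp : 0 < ε / (4 * C + 4) / 2 := by positivity
    obtain ⟨N, hN⟩ := eventually_atTop.1 ((hg _ hp).and (hh _ hp))
    refine ⟨N, fun m hm n hn => ?_⟩
    have := abs_simpleIntegral_sub_le hμ hC (g m) (h n) (δ := ε / (4 * C + 4)) (by positivity)
      (fun x => by
        have h1 := (hN m hm).1 x
        have h2 := (hN n hn).2 x
        rw [Real.dist_eq] at h1 h2
        have h3 := abs_sub_lt_iff.1 h1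
        have h4 := abs_sub_lt_iff.1 h2
        rw [abs_le]
        constructor <;> linarith)
    refine this.trans_lt ?_
    rw [div_mul_eq_mul_div, div_lt_iff₀ (by positivity)]
    nlinarith
  obtain ⟨g, hg⟩ := exists_tendstoUniformly f
  have hc : CauchySeq fun n => simpleIntegral μ (g n) :=
    Metric.cauchySeq_iff.2 fun ε hε => close g g hg hg ε hε
  obtain ⟨I, hI⟩ := cauchySeq_tendsto_of_complete hc
  refine ⟨I, fun h hh => ?_, fun J hJ => tendsto_nhds_unique (hJ g hg) hI⟩
  have h0 : Tendsto (fun n => simpleIntegral μ (h n) - simpleIntegral μ (g n)) atTop (𝓝 0) := by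
    rw [Metric.tendsto_atTop]
    intro ε hε
    obtain ⟨N, hN⟩ := close h g hh hg ε hε
    exact ⟨N, fun n hn => by simpa [Real.dist_eq] using hN n hn n hn⟩
  simpa using h0.add hI

/-- The Markov operator `(A μ)(E) = ∫ p(x, E) μ(dx)` of the transition function
`p(x, E) = κ x E`. -/
noncomputable def markovOp {X : Type*} [MeasurableSpace X] (κ : ProbabilityTheory.Kernel X X)
    (μ : SetFun X) : SetFun X :=
  fun E => faIntegral μ (fun x => (κ x).real (E : Set X))

/-- `Δ_ba`: the invariant finitely additive probability measures. -/
def Dba {X : Type*} [MeasurableSpace X] (κ : ProbabilityTheory.Kernel X X) : Set (SetFun X) :=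
  {μ | μ ∈ Sba X ∧ markovOp κ μ = μ}

/-- The Cesàro averages `(1/n) ∑_{k=1}^n A^k η`. -/
noncomputable def cesaro {X : Type*} [MeasurableSpace X] (κ : ProbabilityTheory.Kernel X X)
    (η : SetFun X) (n : ℕ) : SetFun X :=
  (1 / (n : ℝ)) • ∑ k ∈ Finset.Icc 1 n, (markovOp κ)^[k] η

/-- The topology `τ_B`: the coarsest one for which `μ ↦ ∫ f dμ` is continuous for each
`f ∈ B(X, Σ)`. -/
@[reducible] noncomputable def tauB (X : Type*) [MeasurableSpace X] : TopologicalSpace (SetFun X) :=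
  ⨅ f : BFun X, TopologicalSpace.induced (fun μ => faIntegral μ f.1) inferInstance

/-- Convergence of a sequence in the topology `τ_B`. -/
def TendstoTauB {X : Type*} [MeasurableSpace X] (u : ℕ → SetFun X) (μ : SetFun X) : Prop :=
  Tendsto u atTop (@nhds (SetFun X) (tauB X) μ)

/-- A cycle of period `n ≥ 2`: pairwise distinct `ν_1, …, ν_n ∈ S_ba` with `A ν_i = ν_{i+1}`
for `i < n` and `A ν_n = ν_1`. -/
def IsCycle {X : Type*} [MeasurableSpace X] (κ : ProbabilityTheory.Kernel X X)
    (n : ℕ) (ν : Fin n → SetFun X) : Prop :=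
  2 ≤ n ∧ Function.Injective ν ∧ (∀ i, ν i ∈ Sba X) ∧ ∀ i, markovOp κ (ν i) = ν (finRotate n i)

/-- `μ` is composite: it is the mean `(1/n) ∑ ν_i` of the measures of one cycle. -/
def IsComposite {X : Type*} [MeasurableSpace X] (κ : ProbabilityTheory.Kernel X X)
    (μ : SetFun X) : Prop :=
  ∃ (n : ℕ) (ν : Fin n → SetFun X), IsCycle κ n ν ∧ μ = (1 / (n : ℝ)) • ∑ i, ν i

/-- An invariant `μ` is simple if it is not composite. -/
def IsSimpleInvariant {X : Type*} [MeasurableSpace X] (κ : ProbabilityTheory.Kernel X X)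
    (μ : SetFun X) : Prop :=
  μ ∈ Dba κ ∧ ¬ IsComposite κ μ

end FAMarkov

namespace FAMarkov

/-! Finitely additive probabilities are the means (positive normalized functionals) on bounded
measurable functions. They form a weak* compact set, and `A` is the adjoint of `P f(x) = ∫ f(y) p(x,
dy)`. If the Cesàro averages of `P^k f` did not converge uniformly to `∫ f dμ`, a limit of offending
averages would be a second invariant mean; so uniqueness forces uniform convergence
(`cesaroAct_uniform`), and integrating it against `η` settles the averages. Started at one point,
the averages are measures converging setwise to `μ`, so `μ` is countably additive by a Nikodym
argument (`mem_ca_of_tendsto`).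

For the powers themselves, write `m` for `μ` as a measure. A Vitali–Hahn–Saks argument shows that
the `n`-step probabilities are, up to `δ` and uniformly in the starting point, absolutely continuous
with respect to `m` (`UniformCesaro.uac`). With weak compactness in `L²(m)` and an Egorov argument
this makes `P` quasi-compact (`UniformCesaro.exists_net`). The limit of `P^n` along an idempotent
ultrafilter is then an idempotent kernel `E`, with an inverse `R` of `κ` on its range.

Quasi-compactness bounds the number of mutually singular `E`-fixed probabilities, and `κ` permutes a
maximal family of them, so these are periodic. If `μ` is simple, every periodic probability is `μ`,
since a longer orbit would be a cycle with mean `μ`. Hence every `E x` equals `m`: some `P^n f` is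
uniformly close to `∫ f dm`, and so are all later ones, because `P` is a contraction fixing
constants. -/

open ProbabilityTheory

variable {X : Type*} [MeasurableSpace X]

/-! ### Means on bounded measurable functions. -/

/-- Bounded measurable functions. -/
def Bdd (f : X → ℝ) : Prop := Measurable f ∧ ∃ C : ℝ, ∀ x, |f x| ≤ C

theorem Bdd.of_unit {f : X → ℝ} (hf : Measurable f) (h : ∀ x, |f x| ≤ 1) : Bdd f := ⟨hf, 1, h⟩

theorem Bdd.add {f g : X → ℝ} (hf : Bdd f) (hg : Bdd g) : Bdd (f + g) := by
  obtain ⟨hf, C, hC⟩ := hf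
  obtain ⟨hg, D, hD⟩ := hg
  exact ⟨hf.add hg, C + D, fun x => (abs_add_le _ _).trans (add_le_add (hC x) (hD x))⟩

theorem Bdd.smul {f : X → ℝ} (c : ℝ) (hf : Bdd f) : Bdd (c • f) := by
  obtain ⟨hf, C, hC⟩ := hf
  refine ⟨hf.const_smul c, |c| * C, fun x => ?_⟩
  simp only [Pi.smul_apply, smul_eq_mul, abs_mul]
  exact mul_le_mul_of_nonneg_left (hC x) (abs_nonneg c)

theorem Bdd.sub {f g : X → ℝ} (hf : Bdd f) (hg : Bdd g) : Bdd (f - g) := by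
  have := hf.add (hg.smul (-1))
  rwa [neg_one_smul, ← sub_eq_add_neg] at this

theorem Bdd.const (c : ℝ) : Bdd (fun _ : X => c) := ⟨measurable_const, |c|, fun _ => le_rfl⟩

theorem Bdd.indicator {E : Set X} (hE : MeasurableSet E) : Bdd (E.indicator (1 : X → ℝ)) :=
  .of_unit (measurable_one.indicator hE) fun x => by
    by_cases h : x ∈ E <;> simp [h]

theorem Bdd.simple (g : SimpleFunc X ℝ) : Bdd g :=
  ⟨g.measurable, by
    obtain ⟨C, hC⟩ := g.exists_forall_norm_le
    exact ⟨C, hC⟩⟩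

theorem Bdd.sum {ι : Type*} (s : Finset ι) {f : ι → X → ℝ} (hf : ∀ i ∈ s, Bdd (f i)) :
    Bdd (∑ i ∈ s, f i) := by
  classical
  induction s using Finset.induction_on with
  | empty => exact Bdd.const (X := X) 0
  | insert a s ha ih =>
    rw [Finset.sum_insert ha]
    exact (hf a (by simp)).add (ih fun i hi => hf i (by simp [hi]))

theorem Bdd.integrable {f : X → ℝ} (hf : Bdd f) (ν : Measure X) [IsFiniteMeasure ν] :
    Integrable f ν := by
  obtain ⟨hf, C, hC⟩ := hf
  exact Integrable.of_bound hf.aestronglyMeasurable C (.of_forall hC)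

/-- Positive normalized linear functionals on the bounded measurable functions. -/
structure IsMean (Φ : (X → ℝ) → ℝ) : Prop where
  add : ∀ f g, Bdd f → Bdd g → Φ (f + g) = Φ f + Φ g
  smul : ∀ (c : ℝ) f, Bdd f → Φ (c • f) = c * Φ f
  nonneg : ∀ f, Bdd f → (∀ x, 0 ≤ f x) → 0 ≤ Φ f
  one : Φ (fun _ => 1) = 1

namespace IsMean

variable {Φ : (X → ℝ) → ℝ}

theorem sub (h : IsMean Φ) {f g : X → ℝ} (hf : Bdd f) (hg : Bdd g) : Φ (f - g) = Φ f - Φ g := by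
  have h1 := h.add (f - g) g (hf.sub hg) hg
  rw [sub_add_cancel] at h1
  linarith

theorem const (h : IsMean Φ) (c : ℝ) : Φ (fun _ => c) = c := by
  have := h.smul c _ (Bdd.const 1)
  rw [h.one, mul_one] at this
  convert this using 2
  ext x
  simp

theorem mono (h : IsMean Φ) {f g : X → ℝ} (hf : Bdd f) (hg : Bdd g) (hfg : ∀ x, f x ≤ g x) :
    Φ f ≤ Φ g := by
  have h1 := h.nonneg (g - f) (hg.sub hf) (fun x => sub_nonneg.2 (hfg x))
  rw [h.sub hg hf] at h1
  linarith

theorem dist_le (h : IsMean Φ) {f g : X → ℝ} (hf : Bdd f) (hg : Bdd g) {C : ℝ}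
    (hC : ∀ x, |f x - g x| ≤ C) : |Φ f - Φ g| ≤ C := by
  rw [← h.sub hf hg, abs_le]
  constructor
  · rw [← h.const (-C)]
    exact h.mono (Bdd.const _) (hf.sub hg) fun x => (abs_le.1 (hC x)).1
  · rw [← h.const C]
    exact h.mono (hf.sub hg) (Bdd.const _) fun x => (abs_le.1 (hC x)).2

theorem abs_le (h : IsMean Φ) {f : X → ℝ} (hf : Bdd f) {C : ℝ} (hC : ∀ x, |f x| ≤ C) :
    |Φ f| ≤ C := by
  have := h.dist_le hf (Bdd.const 0) (C := C) (by simpa using hC)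
  rwa [h.const, sub_zero] at this

theorem sum (h : IsMean Φ) {ι : Type*} (s : Finset ι) {f : ι → X → ℝ} (hf : ∀ i ∈ s, Bdd (f i)) :
    Φ (∑ i ∈ s, f i) = ∑ i ∈ s, Φ (f i) := by
  classical
  induction s using Finset.induction_on with
  | empty => exact h.const 0
  | insert a s ha ih =>
    rw [Finset.sum_insert ha, Finset.sum_insert ha, h.add _ _ (hf a (by simp))
      (Bdd.sum _ fun i hi => hf i (by simp [hi])), ih fun i hi => hf i (by simp [hi])]

end IsMean

/-! ### The correspondence between means and finitely additive probabilities. -/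

/-- The set function of a functional. -/
noncomputable def toSetFun (Φ : (X → ℝ) → ℝ) : SetFun X := fun E => Φ ((E : Set X).indicator 1)

theorem IsMean.toSetFun_mem {Φ : (X → ℝ) → ℝ} (h : IsMean Φ) : toSetFun Φ ∈ Sba X := by
  have hb : ∀ E : MSet X, Bdd ((E : Set X).indicator (1 : X → ℝ)) := fun E => Bdd.indicator E.2
  refine ⟨⟨?_, ?_, 1, fun E => ?_⟩, fun E => ?_, ?_⟩
  · have := h.const 0
    simp only [toSetFun, Set.indicator_empty]
    exact this
  · intro E F hEF
    simp only [toSetFun]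
    rw [Set.indicator_union_of_disjoint hEF]
    exact h.add _ _ (hb E) (hb F)
  · refine h.abs_le (hb E) fun x => ?_
    by_cases hx : x ∈ (E : Set X) <;> simp [hx]
  · exact h.nonneg _ (hb E) fun x => Set.indicator_nonneg (fun _ _ => zero_le_one) x
  · simp only [toSetFun, Set.indicator_univ]
    exact h.one

theorem IsMean.simpleIntegral_toSetFun {Φ : (X → ℝ) → ℝ} (h : IsMean Φ) (g : SimpleFunc X ℝ) :
    simpleIntegral (toSetFun Φ) g = Φ g := by
  have : (g : X → ℝ) = ∑ y ∈ g.range, y • (g ⁻¹' {y}).indicator (1 : X → ℝ) := by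
    ext x
    simp only [Finset.sum_apply, Pi.smul_apply, smul_eq_mul]
    rw [Finset.sum_eq_single (g x)]
    · simp
    · intro y _ hy
      simp [hy.symm]
    · simp
  conv_rhs => rw [this]
  rw [h.sum _ fun y _ => (Bdd.indicator (g.measurableSet_fiber y)).smul y]
  exact Finset.sum_congr rfl fun y _ => (h.smul y _ (Bdd.indicator (g.measurableSet_fiber y))).symm

theorem hasFAIntegral_faIntegral {η : SetFun X} (hη : η ∈ ba X) {f : X → ℝ} (hf : Bdd f) :
    HasFAIntegral η f (faIntegral η f) :=
  Classical.epsilon_spec (existsUnique_hasFAIntegral hη ⟨f, hf⟩).exists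

theorem Bdd.exists_tendstoUniformly {f : X → ℝ} (hf : Bdd f) :
    ∃ g : ℕ → SimpleFunc X ℝ, TendstoUniformly (fun n x => g n x) f atTop :=
  FAMarkov.exists_tendstoUniformly ⟨f, hf⟩

/-- A mean is 1-Lipschitz for the sup norm, so it is determined by its values on simple functions:
it is the integral against its own set function. -/
theorem IsMean.faIntegral_toSetFun {Φ : (X → ℝ) → ℝ} (h : IsMean Φ) {f : X → ℝ} (hf : Bdd f) :
    faIntegral (toSetFun Φ) f = Φ f := by
  obtain ⟨g, hg⟩ := hf.exists_tendstoUniformly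
  refine tendsto_nhds_unique (hasFAIntegral_faIntegral h.toSetFun_mem.1 hf g hg) ?_
  simp only [h.simpleIntegral_toSetFun]
  rw [Metric.tendsto_nhds]
  intro ε hε
  filter_upwards [Metric.tendstoUniformly_iff.1 hg (ε / 2) (half_pos hε)] with n hn
  refine lt_of_le_of_lt (h.dist_le (Bdd.simple _) hf fun x => ?_) (half_lt_self hε)
  rw [← Real.dist_eq, dist_comm]
  exact (hn x).le

theorem faIntegral_sub {η : SetFun X} (hη : η ∈ ba X) {f g : X → ℝ} (hf : Bdd f) (hg : Bdd g) :
    faIntegral η (f - g) = faIntegral η f - faIntegral η g := by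
  obtain ⟨u, hu⟩ := hf.exists_tendstoUniformly
  obtain ⟨v, hv⟩ := hg.exists_tendstoUniformly
  have h1 := hasFAIntegral_faIntegral hη (hf.sub hg) (fun n => u n - v n) (hu.sub hv)
  simp only [simpleIntegral_sub hη] at h1
  exact tendsto_nhds_unique h1 ((hasFAIntegral_faIntegral hη hf u hu).sub
    (hasFAIntegral_faIntegral hη hg v hv))

theorem simpleIntegral_indicator {η : SetFun X} (hη : η ∈ ba X) (c : ℝ) (E : MSet X) :
    simpleIntegral η (SimpleFunc.piecewise (E : Set X) E.2 (SimpleFunc.const X c)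
      (SimpleFunc.const X 0)) = c * η E := by
  classical
  set g := SimpleFunc.piecewise (E : Set X) E.2 (SimpleFunc.const X c) (SimpleFunc.const X 0)
    with hg
  have hgx : ∀ x, g x = (E : Set X).indicator (fun _ => c) x := by
    intro x
    simp [g, Set.piecewise, Set.indicator_apply]
  -- For `c = 0` the fibre over `c` is the whole space instead of `E`.
  by_cases hc : c = 0
  · have : ∀ x, g x = 0 := by
      intro x
      simp [hgx, hc]
    unfold simpleIntegral
    rw [hc, zero_mul]
    refine Finset.sum_eq_zero fun y hy => ?_
    obtain ⟨x, rfl⟩ := SimpleFunc.mem_range.1 hy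
    rw [this x, zero_mul]
  · have hpre : g ⁻¹' {c} = E := by
      ext x
      by_cases hx : x ∈ (E : Set X)
      · simp [hgx, hx]
      · simp [hgx, hx, Ne.symm hc]
    unfold simpleIntegral
    rw [Finset.sum_eq_single c]
    · congr 2
      exact Subtype.ext hpre
    · intro y hy hyc
      obtain ⟨x, rfl⟩ := SimpleFunc.mem_range.1 hy
      by_cases hx : x ∈ (E : Set X)
      · simp [hgx, hx] at hyc
      · simp [hgx, hx]
    -- If `c` is not a value, then `E` is empty and both sides vanish.
    · intro hcr
      have : (⟨g ⁻¹' {c}, g.measurableSet_fiber c⟩ : MSet X) = ⟨∅, MeasurableSet.empty⟩ := by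
        refine Subtype.ext (Set.eq_empty_of_forall_notMem fun x hx => hcr ?_)
        exact SimpleFunc.mem_range.2 ⟨x, hx⟩
      rw [this, hη.1, mul_zero]

theorem faIntegral_smul_indicator {η : SetFun X} (hη : η ∈ ba X) (c : ℝ) (E : MSet X) :
    faIntegral η (c • (E : Set X).indicator 1) = c * η E := by
  have h := hasFAIntegral_faIntegral hη ((Bdd.indicator E.2).smul c)
    (fun _ => SimpleFunc.piecewise (E : Set X) E.2 (SimpleFunc.const X c) (SimpleFunc.const X 0)) (by
      classical
      rw [Metric.tendstoUniformly_iff]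
      refine fun ε hε => .of_forall fun n x => ?_
      by_cases hx : x ∈ (E : Set X) <;> simp [hx, hε, Set.piecewise])
  simp only [simpleIntegral_indicator hη] at h
  exact tendsto_nhds_unique h tendsto_const_nhds

theorem faIntegral_indicator {η : SetFun X} (hη : η ∈ ba X) (E : MSet X) :
    faIntegral η ((E : Set X).indicator 1) = η E := by
  simpa using faIntegral_smul_indicator hη 1 E

theorem faIntegral_smul {η : SetFun X} (hη : η ∈ ba X) (c : ℝ) {f : X → ℝ} (hf : Bdd f) :
    faIntegral η (c • f) = c * faIntegral η f := by
  obtain ⟨u, hu⟩ := hf.exists_tendstoUniformly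
  have hu' : TendstoUniformly (fun n x => (c • u n : SimpleFunc X ℝ) x) (c • f) atTop := by
    have := (uniformContinuous_const_smul c (M := ℝ) (X := ℝ)).comp_tendstoUniformly hu
    exact this
  refine tendsto_nhds_unique (hasFAIntegral_faIntegral hη (hf.smul c) _ hu') ?_
  have key : ∀ g : SimpleFunc X ℝ, simpleIntegral η (c • g) = c * simpleIntegral η g := by
    intro g
    classical
    let T : Set X → ℝ →L[ℝ] ℝ := fun s =>
      (if hs : MeasurableSet s then η ⟨s, hs⟩ else 0) • ContinuousLinearMap.id ℝ ℝ
    have hT : FinMeasAdditive (0 : Measure X) T := by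
      intro s t hs ht _ _ hst
      simp only [T, hs, ht, hs.union ht, dif_pos, ← add_smul]
      rw [hη.2.1 ⟨s, hs⟩ ⟨t, ht⟩ hst]
    have key : ∀ g : SimpleFunc X ℝ, simpleIntegral η g = g.setToSimpleFunc T := by
      intro g
      refine Finset.sum_congr rfl fun y _ => ?_
      simp [T, g.measurableSet_fiber y, mul_comm]
    rw [key, key]
    exact SimpleFunc.setToSimpleFunc_smul_real T hT c (by simp)
  simp only [key]
  exact (hasFAIntegral_faIntegral hη hf u hu).const_mul c

theorem faIntegral_nonneg {η : SetFun X} (hη : η ∈ Sba X) {f : X → ℝ} (hf : Bdd f)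
    (h0 : ∀ x, 0 ≤ f x) : 0 ≤ faIntegral η f := by
  obtain ⟨u, hu⟩ := hf.exists_tendstoUniformly
  -- Since `f ≥ 0`, absolute values of the approximants still approximate `f`, and their integrals
  -- are visibly nonnegative.
  have hu' : TendstoUniformly (fun n x => ((u n).map abs : SimpleFunc X ℝ) x) f atTop := by
    rw [Metric.tendstoUniformly_iff] at hu ⊢
    intro ε hε
    filter_upwards [hu ε hε] with n hn x
    refine lt_of_le_of_lt ?_ (hn x)
    rw [Real.dist_eq, Real.dist_eq, SimpleFunc.map_apply]
    conv_lhs => rw [← abs_of_nonneg (h0 x)]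
    exact abs_abs_sub_abs_le_abs_sub _ _
  refine ge_of_tendsto' (hasFAIntegral_faIntegral hη.1 hf _ hu') fun n => ?_
  refine Finset.sum_nonneg fun y hy => mul_nonneg ?_ (hη.2.1 _)
  obtain ⟨x, rfl⟩ := SimpleFunc.mem_range.1 hy
  simp

theorem isMean_faIntegral {η : SetFun X} (hη : η ∈ Sba X) : IsMean (faIntegral η) where
  add f g hf hg := by
    have h := faIntegral_sub hη.1 hf (hg.smul (-1))
    rw [faIntegral_smul hη.1 _ hg] at h
    rw [neg_one_smul, sub_neg_eq_add] at h
    rw [h]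
    ring
  smul c f hf := faIntegral_smul hη.1 c hf
  nonneg f hf h := faIntegral_nonneg hη hf h
  one := by
    have := faIntegral_indicator hη.1 ⟨Set.univ, MeasurableSet.univ⟩
    simp only [hη.2.2, Set.indicator_univ] at this
    exact this

theorem isMean_integral (ν : Measure X) [IsProbabilityMeasure ν] :
    IsMean (fun f => ∫ x, f x ∂ν) where
  add f g hf hg := integral_add (hf.integrable ν) (hg.integrable ν)
  smul c f _ := by simp [integral_const_mul]
  nonneg f _ h := integral_nonneg h
  one := by simp

theorem IsMean.lim {ι : Type*} (U : Filter ι) [U.NeBot] {Φ : ι → (X → ℝ) → ℝ} {Ψ : (X → ℝ) → ℝ}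
    (h : ∀ i, IsMean (Φ i)) (hl : ∀ f, Bdd f → Tendsto (fun i => Φ i f) U (𝓝 (Ψ f))) :
    IsMean Ψ where
  add f g hf hg := by
    have h1 := hl _ (hf.add hg)
    simp only [(h _).add f g hf hg] at h1
    exact tendsto_nhds_unique h1 ((hl f hf).add (hl g hg))
  smul c f hf := by
    have h1 := hl _ (hf.smul c)
    simp only [(h _).smul c f hf] at h1
    exact tendsto_nhds_unique h1 ((hl f hf).const_mul c)
  nonneg f hf h0 := ge_of_tendsto' (hl f hf) fun i => (h i).nonneg f hf h0
  one := by
    have h1 := hl _ (Bdd.const 1)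
    simp only [(h _).one] at h1
    exact tendsto_nhds_unique h1 tendsto_const_nhds

/-! ### Compactness of the set of means. -/

theorem exists_tendsto_of_abs_le {ι : Type*} (U : Ultrafilter ι) {a : ι → ℝ} {C : ℝ}
    (h : ∀ i, |a i| ≤ C) : ∃ l, Tendsto a U (𝓝 l) := by
  have := (isCompact_Icc (a := -C) (b := C)).ultrafilter_le_nhds (U.map a) (by
    rw [le_principal_iff]
    exact Ultrafilter.mem_map.2 (Filter.Eventually.of_forall fun i => abs_le.1 (h i)))
  obtain ⟨l, _, hl⟩ := this
  exact ⟨l, hl⟩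

/-- Weak* compactness in ultrafilter form: each coordinate stays in a compact interval. The values
off `Bdd` are immaterial. -/
theorem exists_isMean_lim {ι : Type*} (U : Ultrafilter ι) {Φ : ι → (X → ℝ) → ℝ}
    (h : ∀ i, IsMean (Φ i)) :
    ∃ Ψ, IsMean Ψ ∧ ∀ f, Bdd f → Tendsto (fun i => Φ i f) U (𝓝 (Ψ f)) := by
  have : ∀ f : X → ℝ, ∃ l, Bdd f → Tendsto (fun i => Φ i f) U (𝓝 l) := by
    intro f
    by_cases hf : Bdd f
    · obtain ⟨C, hC⟩ := hf.2
      obtain ⟨l, hl⟩ := exists_tendsto_of_abs_le U (fun i => (h i).abs_le hf hC)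
      exact ⟨l, fun _ => hl⟩
    · exact ⟨0, fun h => absurd h hf⟩
  choose Ψ hΨ using this
  exact ⟨Ψ, .lim U h hΨ, hΨ⟩

/-! ### The Markov operator as an adjoint; Cesàro averages. -/

/-- The action of a kernel on functions. -/
noncomputable def act (κ : Kernel X X) (f : X → ℝ) : X → ℝ := fun x => ∫ y, f y ∂κ x

instance isMarkovKernel_pow (κ : Kernel X X) [IsMarkovKernel κ] (n : ℕ) :
    IsMarkovKernel (κ ^ n) := by
  induction n with
  | zero => exact inferInstanceAs (IsMarkovKernel Kernel.id)
  | succ n ih => exact inferInstanceAs (IsMarkovKernel ((κ ^ n) ∘ₖ κ))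

theorem isMean_act (κ : Kernel X X) [IsMarkovKernel κ] (x : X) : IsMean (fun f => act κ f x) :=
  isMean_integral (κ x)

theorem abs_act_le (κ : Kernel X X) [IsMarkovKernel κ] {f : X → ℝ} (hf : Bdd f) {C : ℝ}
    (hC : ∀ x, |f x| ≤ C) (x : X) : |act κ f x| ≤ C :=
  (isMean_act κ x).abs_le hf hC

theorem Bdd.act {f : X → ℝ} (hf : Bdd f) (κ : Kernel X X) [IsMarkovKernel κ] : Bdd (act κ f) := by
  obtain ⟨C, hC⟩ := hf.2
  exact ⟨hf.1.stronglyMeasurable.integral_kernel.measurable, C, abs_act_le κ hf hC⟩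

theorem act_comp (η κ : Kernel X X) [IsMarkovKernel η] [IsMarkovKernel κ] {f : X → ℝ} (hf : Bdd f) :
    FAMarkov.act (η ∘ₖ κ) f = act κ (act η f) :=
  funext fun _ => Kernel.integral_comp (hf.integrable _)

theorem act_pow_add (κ : Kernel X X) [IsMarkovKernel κ] (m n : ℕ) {f : X → ℝ} (hf : Bdd f) :
    act (κ ^ (m + n)) f = act (κ ^ n) (act (κ ^ m) f) := by
  rw [Kernel.pow_add, act_comp _ _ hf]

theorem act_pow_one (κ : Kernel X X) (f : X → ℝ) : act (κ ^ 1) f = act κ f := by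
  rw [pow_one]

theorem act_pow_zero (κ : Kernel X X) {f : X → ℝ} (hf : Bdd f) : act (κ ^ 0) f = f := by
  funext x
  have : (κ ^ 0) x = Measure.dirac x := Kernel.id_apply x
  rw [act, this, integral_dirac' _ _ hf.1.stronglyMeasurable]

theorem act_indicator (κ : Kernel X X) {E : Set X} (hE : MeasurableSet E) (x : X) :
    act κ (E.indicator 1) x = (κ x).real E :=
  integral_indicator_one hE

theorem IsMean.comp {Φ : (X → ℝ) → ℝ} (h : IsMean Φ) {T : (X → ℝ) → X → ℝ}
    (hb : ∀ f, Bdd f → Bdd (T f)) (hT : ∀ x, IsMean (fun f => T f x)) :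
    IsMean (fun f => Φ (T f)) where
  add f g hf hg := by
    rw [← h.add _ _ (hb f hf) (hb g hg)]
    congr 1
    exact funext fun x => (hT x).add f g hf hg
  smul c f hf := by
    rw [← h.smul c _ (hb f hf)]
    congr 1
    exact funext fun x => (hT x).smul c f hf
  nonneg f hf h0 := h.nonneg _ (hb f hf) fun x => (hT x).nonneg f hf h0
  one := by
    rw [show T (fun _ => 1) = fun _ => 1 from funext fun x => (hT x).one]
    exact h.one

/-- This exhibits `markovOp κ` as the adjoint of `act κ`, so that questions about set functions
become questions about functions. -/
theorem markovOp_eq (κ : Kernel X X) (η : SetFun X) :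
    markovOp κ η = toSetFun (fun f => faIntegral η (act κ f)) := by
  funext E
  simp only [markovOp, toSetFun]
  congr 1
  exact funext fun x => (act_indicator κ E.2 x).symm

theorem markovOp_mem (κ : Kernel X X) [IsMarkovKernel κ] {η : SetFun X} (hη : η ∈ Sba X) :
    markovOp κ η ∈ Sba X := by
  rw [markovOp_eq]
  exact ((isMean_faIntegral hη).comp (fun f hf => hf.act κ) (isMean_act κ)).toSetFun_mem

theorem faIntegral_markovOp (κ : Kernel X X) [IsMarkovKernel κ] {η : SetFun X} (hη : η ∈ Sba X)
    {f : X → ℝ} (hf : Bdd f) : faIntegral (markovOp κ η) f = faIntegral η (act κ f) := by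
  rw [markovOp_eq]
  exact ((isMean_faIntegral hη).comp (fun f hf => hf.act κ) (isMean_act κ)).faIntegral_toSetFun hf

theorem iterate_mem (κ : Kernel X X) [IsMarkovKernel κ] {η : SetFun X} (hη : η ∈ Sba X) (n : ℕ) :
    (markovOp κ)^[n] η ∈ Sba X := by
  induction n with
  | zero => exact hη
  | succ n ih =>
    rw [Function.iterate_succ_apply']
    exact markovOp_mem κ ih

theorem faIntegral_iterate (κ : Kernel X X) [IsMarkovKernel κ] {η : SetFun X} (hη : η ∈ Sba X)
    (n : ℕ) {f : X → ℝ} (hf : Bdd f) :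
    faIntegral ((markovOp κ)^[n] η) f = faIntegral η (act (κ ^ n) f) := by
  induction n generalizing f with
  | zero => rw [act_pow_zero κ hf]; rfl
  | succ n ih =>
    rw [Function.iterate_succ_apply', faIntegral_markovOp κ (iterate_mem κ hη n) hf,
      ih (hf.act κ), add_comm n 1, act_pow_add κ 1 n hf, act_pow_one]

/-- The Cesàro averages of the action on functions. -/
noncomputable def cesaroAct (κ : Kernel X X) (n : ℕ) (f : X → ℝ) : X → ℝ :=
  (1 / (n : ℝ)) • ∑ k ∈ Finset.Icc 1 n, act (κ ^ k) f

theorem cesaroAct_apply (κ : Kernel X X) (n : ℕ) (f : X → ℝ) (x : X) :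
    cesaroAct κ n f x = (1 / (n : ℝ)) * ∑ k ∈ Finset.Icc 1 n, act (κ ^ k) f x := by
  simp [cesaroAct]

theorem Bdd.cesaroAct {f : X → ℝ} (hf : Bdd f) (κ : Kernel X X) [IsMarkovKernel κ] (n : ℕ) :
    Bdd (cesaroAct κ n f) :=
  (Bdd.sum _ fun k _ => hf.act (κ ^ k)).smul _

theorem isMean_average {ι : Type*} {s : Finset ι} (hs : s.Nonempty) {Φ : ι → (X → ℝ) → ℝ}
    (h : ∀ i ∈ s, IsMean (Φ i)) : IsMean (fun f => (1 / (s.card : ℝ)) * ∑ i ∈ s, Φ i f) where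
  add f g hf hg := by
    rw [← mul_add, ← Finset.sum_add_distrib]
    exact congrArg _ (Finset.sum_congr rfl fun i hi => (h i hi).add f g hf hg)
  smul c f hf := by
    rw [mul_left_comm, Finset.mul_sum (a := c)]
    exact congrArg _ (Finset.sum_congr rfl fun i hi => (h i hi).smul c f hf)
  nonneg f hf h0 :=
    mul_nonneg (by positivity) (Finset.sum_nonneg fun i hi => (h i hi).nonneg f hf h0)
  one := by
    rw [Finset.sum_congr rfl fun i hi => (h i hi).one]
    have : (s.card : ℝ) ≠ 0 := by exact_mod_cast hs.card_ne_zero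
    simp [this]

theorem isMean_cesaroAct (κ : Kernel X X) [IsMarkovKernel κ] {n : ℕ} (hn : n ≠ 0) (x : X) :
    IsMean (fun f => cesaroAct κ n f x) := by
  have := isMean_average (s := Finset.Icc 1 n) (by simp; omega) (fun k _ => isMean_act (κ ^ k) x)
  simp only [cesaroAct_apply]
  simpa using this

/-- The sums telescope to the difference of the terms of index `n + 1` and `1`, each bounded by `C`.
Limits of Cesàro averages are therefore invariant. -/
theorem abs_cesaroAct_act_sub_le (κ : Kernel X X) [IsMarkovKernel κ] (n : ℕ) {f : X → ℝ}
    (hf : Bdd f) {C : ℝ} (hC : ∀ x, |f x| ≤ C) (x : X) :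
    |cesaroAct κ n (act κ f) x - cesaroAct κ n f x| ≤ 1 / (n : ℝ) * (2 * C) := by
  rw [cesaroAct_apply, cesaroAct_apply, ← mul_sub, ← Finset.sum_sub_distrib, abs_mul,
    abs_of_nonneg (by positivity : (0 : ℝ) ≤ 1 / n)]
  refine mul_le_mul_of_nonneg_left ?_ (by positivity)
  have h1 : ∀ k, act (κ ^ k) (act κ f) x = act (κ ^ (k + 1)) f x := fun k => by
    rw [add_comm, act_pow_add κ 1 k hf, act_pow_one]
  simp only [h1]
  have h2 : Finset.Icc 1 n = Finset.Ico 1 (n + 1) := rfl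
  rw [h2, Finset.sum_Ico_sub (fun k => act (κ ^ k) f x) (by omega)]
  have := abs_act_le (κ ^ (n + 1)) hf hC x
  have := abs_act_le (κ ^ 1) hf hC x
  refine (abs_sub _ _).trans ?_
  linarith

theorem cesaro_eq (κ : Kernel X X) [IsMarkovKernel κ] {η : SetFun X} (hη : η ∈ Sba X) (n : ℕ) :
    cesaro κ η n = toSetFun (fun f => faIntegral η (cesaroAct κ n f)) := by
  funext E
  have hb : Bdd ((E : Set X).indicator (1 : X → ℝ)) := Bdd.indicator E.2
  have h := isMean_faIntegral hη
  simp only [cesaro, toSetFun, cesaroAct, Pi.smul_apply, Finset.sum_apply, smul_eq_mul]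
  rw [h.smul _ _ (Bdd.sum _ fun k _ => hb.act (κ ^ k)), h.sum _ fun k _ => hb.act (κ ^ k)]
  refine congrArg _ (Finset.sum_congr rfl fun k _ => ?_)
  rw [← faIntegral_iterate κ hη k hb, faIntegral_indicator (iterate_mem κ hη k).1]

theorem isMean_faIntegral_cesaroAct (κ : Kernel X X) [IsMarkovKernel κ] {η : SetFun X}
    (hη : η ∈ Sba X) {n : ℕ} (hn : n ≠ 0) :
    IsMean (fun f => faIntegral η (cesaroAct κ n f)) :=
  (isMean_faIntegral hη).comp (fun _ hf => hf.cesaroAct κ n) (isMean_cesaroAct κ hn)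

theorem mem_Dba_of_act {κ : Kernel X X} {Φ : (X → ℝ) → ℝ} [IsMarkovKernel κ] (h : IsMean Φ)
    (hi : ∀ f, Bdd f → Φ (act κ f) = Φ f) : toSetFun Φ ∈ Dba κ := by
  refine ⟨h.toSetFun_mem, ?_⟩
  rw [markovOp_eq]
  funext E
  have hb : Bdd ((E : Set X).indicator (1 : X → ℝ)) := Bdd.indicator E.2
  simp only [toSetFun]
  exact (h.faIntegral_toSetFun (hb.act κ)).trans (hi _ hb)

/-! ### Uniform convergence of the Cesàro averages. -/

/-- Unique ergodicity makes the Cesàro averages converge uniformly. -/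
theorem cesaroAct_uniform (κ : Kernel X X) [IsMarkovKernel κ] {μ : SetFun X} (hμ : Dba κ = {μ})
    {f : X → ℝ} (hf : Bdd f) {ε : ℝ} (hε : 0 < ε) :
    ∃ N : ℕ, ∀ n ≥ N, ∀ x, |cesaroAct κ n f x - faIntegral μ f| ≤ ε := by
  by_contra! hcon
  choose n hn x hx using fun j : ℕ => hcon (j + 1)
  have hn0 : ∀ j, n j ≠ 0 := fun j => by have := hn j; omega
  have hnt : Tendsto n atTop atTop := tendsto_atTop_mono (fun j => (Nat.le_succ j).trans (hn j)) tendsto_id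
  -- A limit of the offending averages is an invariant mean, hence integration against `μ`; but its
  -- value at `f` would have to stay `ε` away from `faIntegral μ f`.
  obtain ⟨Ψ, hΨ, hl⟩ := exists_isMean_lim (hyperfilter ℕ)
    (fun j => isMean_cesaroAct κ (hn0 j) (x j))
  have hat : (hyperfilter ℕ : Filter ℕ) ≤ atTop := Nat.hyperfilter_le_atTop
  have hinv : ∀ g, Bdd g → Ψ (act κ g) = Ψ g := by
    intro g hg
    obtain ⟨C, hC⟩ := hg.2
    have h1 := (hl _ (hg.act κ)).sub (hl g hg)
    have h2 : Tendsto (fun j => cesaroAct κ (n j) (act κ g) (x j) - cesaroAct κ (n j) g (x j))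
        (hyperfilter ℕ) (𝓝 0) := by
      refine squeeze_zero_norm (fun j => abs_cesaroAct_act_sub_le κ (n j) hg hC (x j)) ?_
      have : Tendsto (fun j => 1 / ((n j : ℕ) : ℝ) * (2 * C)) atTop (𝓝 (0 * (2 * C))) :=
        (tendsto_one_div_atTop_nhds_zero_nat.comp hnt).mul_const _
      rw [zero_mul] at this
      exact this.mono_left hat
    exact sub_eq_zero.1 (tendsto_nhds_unique h1 h2)
  have hmem := mem_Dba_of_act (κ := κ) hΨ hinv
  rw [hμ, Set.mem_singleton_iff] at hmem
  have h3 : faIntegral μ f = Ψ f := by rw [← hmem, hΨ.faIntegral_toSetFun hf]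
  have h4 := ((hl f hf).sub_const (Ψ f)).abs
  rw [sub_self, abs_zero] at h4
  obtain ⟨j, hj⟩ := (h4.eventually (gt_mem_nhds hε)).exists
  have := hx j
  rw [h3] at this
  exact lt_asymm hj this

theorem tendstoTauB_iff {u : ℕ → SetFun X} {μ : SetFun X} :
    TendstoTauB u μ ↔
      ∀ f : X → ℝ, Bdd f → Tendsto (fun n => faIntegral (u n) f) atTop (𝓝 (faIntegral μ f)) := by
  unfold TendstoTauB
  rw [nhds_iInf, tendsto_iInf]
  simp only [nhds_induced, tendsto_comap_iff]
  exact ⟨fun h f hf => h ⟨f, hf⟩, fun h f => h f.1 f.2⟩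

theorem tendsto_of_forall_faIntegral {u : ℕ → SetFun X} {μ : SetFun X} (hμ : μ ∈ Sba X)
    (hu : ∀ᶠ n in atTop, u n ∈ Sba X)
    (h : ∀ f : X → ℝ, Bdd f → Tendsto (fun n => faIntegral (u n) f) atTop (𝓝 (faIntegral μ f))) :
    TendstoTauB u μ ∧ ∀ E : MSet X, Tendsto (fun n => u n E) atTop (𝓝 (μ E)) := by
  refine ⟨tendstoTauB_iff.2 h, fun E => ?_⟩
  have := h _ (Bdd.indicator E.2)
  rw [faIntegral_indicator hμ.1] at this
  refine this.congr' ?_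
  filter_upwards [hu] with n hn
  exact faIntegral_indicator hn.1 E

theorem cesaro_tendsto (κ : Kernel X X) [IsMarkovKernel κ] {μ : SetFun X} (hμ : Dba κ = {μ})
    {η : SetFun X} (hη : η ∈ Sba X) :
    TendstoTauB (cesaro κ η) μ ∧
      ∀ E : MSet X, Tendsto (fun n => cesaro κ η n E) atTop (𝓝 (μ E)) := by
  have hμS : μ ∈ Sba X := (hμ.ge rfl : μ ∈ Dba κ).1
  have hc := cesaro_eq κ hη
  refine tendsto_of_forall_faIntegral hμS ?_ fun f hf => ?_
  -- The average of index `0` is the zero set function, which is not a probability.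
  · filter_upwards [eventually_ne_atTop 0] with n hn
    rw [hc n]
    exact (isMean_faIntegral_cesaroAct κ hη hn).toSetFun_mem
  · rw [Metric.tendsto_atTop]
    intro ε hε
    obtain ⟨N, hN⟩ := cesaroAct_uniform κ hμ hf (half_pos hε)
    refine ⟨N + 1, fun n hn => ?_⟩
    rw [hc n, (isMean_faIntegral_cesaroAct κ hη (by omega)).faIntegral_toSetFun hf, Real.dist_eq]
    refine lt_of_le_of_lt ?_ (half_lt_self hε)
    have := (isMean_faIntegral hη).dist_le (hf.cesaroAct κ n) (Bdd.const (faIntegral μ f))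
      (hN n (by omega))
    rwa [(isMean_faIntegral hη).const] at this

/-! ### A Nikodym convergence theorem and countable additivity. -/

/-- Subsets of `ℕ` are viewed as points of the Cantor space, where Baire's theorem applies;
continuity is the Weierstrass M-test. -/
theorem continuous_tsum_bool {w : ℕ → ℝ} (h0 : ∀ j, 0 ≤ w j) (hs : Summable w) :
    Continuous fun s : ℕ → Bool => ∑' j, if s j = true then w j else 0 := by
  refine continuous_tsum (u := w) (fun j => ?_) hs fun j s => ?_
  · exact (continuous_of_discreteTopology (f := fun b : Bool => if b = true then w j else 0)).comp
      (continuous_apply j)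
  · split_ifs <;> simp [abs_of_nonneg, h0 j]

/-- A Nikodym convergence theorem for measures on `ℕ`: setwise convergence is uniform on the
subsets of some tail. -/
theorem exists_tail_uniform {w : ℕ → ℕ → ℝ} (h0 : ∀ n j, 0 ≤ w n j) (hs : ∀ n, Summable (w n))
    {L : Set ℕ → ℝ} (hL : ∀ S : Set ℕ, Tendsto (fun n => ∑' j, S.indicator (w n) j) atTop (𝓝 (L S)))
    {ε : ℝ} (hε : 0 < ε) :
    ∃ K N : ℕ, ∀ S : Set ℕ, (∀ j ∈ S, K ≤ j) → ∀ n ≥ N, |∑' j, S.indicator (w n) j - L S| ≤ ε := by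
  classical
  set a : ℕ → (ℕ → Bool) → ℝ := fun n s => ∑' j, if s j = true then w n j else 0 with ha
  have ha' : ∀ n s, a n s = ∑' j, {j | s j = true}.indicator (w n) j := fun n s => by
    simp [ha, Set.indicator_apply]
  have hac : ∀ n, Continuous (a n) := fun n => continuous_tsum_bool (h0 n) (hs n)
  -- The closed sets `F N` cover the Cantor space because each sequence `a n s` is Cauchy. By Baire
  -- one of them contains a cylinder, which constrains only finitely many coordinates, all below
  -- some `K`.
  let F : ℕ → Set (ℕ → Bool) := fun N => {s | ∀ n ≥ N, ∀ m ≥ N, |a n s - a m s| ≤ ε / 2}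
  have hF : ∀ N, IsClosed (F N) := by
    intro N
    simp only [F, Set.ofPred_forall]
    refine isClosed_iInter fun n => isClosed_iInter fun _ => isClosed_iInter fun m =>
      isClosed_iInter fun _ => ?_
    exact isClosed_le ((hac n).sub (hac m)).abs continuous_const
  have hU : ⋃ N, F N = Set.univ := by
    refine Set.eq_univ_of_forall fun s => Set.mem_iUnion.2 ?_
    have hc := (hL {j | s j = true}).cauchySeq
    obtain ⟨N, hN⟩ := Metric.cauchySeq_iff.1 hc (ε / 2) (half_pos hε)
    refine ⟨N, fun n hn m hm => ?_⟩
    rw [ha', ha']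
    exact (hN n hn m hm).le
  obtain ⟨N, s₀, hs₀⟩ := nonempty_interior_of_iUnion_of_closed hF hU
  obtain ⟨I, u, hu, hIu⟩ := isOpen_pi_iff.1 isOpen_interior s₀ hs₀
  have hcyl : ∀ s : ℕ → Bool, (∀ i ∈ I, s i = s₀ i) → s ∈ F N := fun s h =>
    interior_subset (hIu fun i hi => by rw [h i hi]; exact (hu i hi).2)
  obtain ⟨K, hK⟩ : ∃ K, ∀ i ∈ I, i < K := ⟨I.sup id + 1, fun i hi =>
    Nat.lt_succ_of_le (Finset.le_sup (f := id) hi)⟩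
  refine ⟨K, N, fun S hS n hn => ?_⟩
  have key : ∀ m ≥ N, |∑' j, S.indicator (w n) j - ∑' j, S.indicator (w m) j| ≤ ε := by
    intro m hm
    -- Both points lie in the cylinder and differ exactly by `S`, so the sum over `S` is a
    -- difference of two values of `a`; its variation is at most `ε / 2 + ε / 2`.
    let s₁ : ℕ → Bool := fun j => if j < K then s₀ j else decide (j ∈ S)
    let s₂ : ℕ → Bool := fun j => if j < K then s₀ j else false
    have h1 := hcyl s₁ (fun i hi => by simp [s₁, hK i hi]) n hn m hm
    have h2 := hcyl s₂ (fun i hi => by simp [s₂, hK i hi]) n hn m hm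
    have h3 : ∀ k, a k s₁ = a k s₂ + ∑' j, S.indicator (w k) j := by
      intro k
      rw [ha', ha', ← ((hs k).indicator _).tsum_add ((hs k).indicator _)]
      refine tsum_congr fun j => ?_
      by_cases hj : j < K
      · have : j ∉ S := fun h => absurd (hS j h) (by omega)
        simp [Set.indicator_apply, s₁, s₂, hj, this]
      · simp [Set.indicator_apply, s₁, s₂, hj]
    rw [h3, h3] at h1
    rw [abs_le] at *
    constructor <;> linarith [h1.1, h1.2, h2.1, h2.2]
  have hlim := ((hL S).const_sub (∑' j, S.indicator (w n) j)).abs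
  exact le_of_tendsto hlim (eventually_atTop.2 ⟨N, key⟩)

theorem real_iUnion_eq_tsum (ν : Measure X) [IsFiniteMeasure ν] {D : ℕ → Set X}
    (hD : ∀ j, MeasurableSet (D j)) (hd : Pairwise fun i j => Disjoint (D i) (D j)) (S : Set ℕ) :
    ν.real (⋃ j ∈ S, D j) = ∑' j, S.indicator (fun j => ν.real (D j)) j := by
  classical
  have h1 : (⋃ j ∈ S, D j) = ⋃ j, (if j ∈ S then D j else ∅ : Set X) := by
    ext x
    simp only [Set.mem_iUnion]
    refine exists_congr fun j => ?_
    by_cases h : j ∈ S <;> simp [h]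
  rw [h1, measureReal_def, measure_iUnion, ENNReal.tsum_toReal_eq (fun _ => measure_ne_top _ _)]
  · refine tsum_congr fun j => ?_
    by_cases h : j ∈ S <;> simp [h, measureReal_def]
  · intro i j hij
    by_cases h : i ∈ S <;> by_cases h' : j ∈ S <;> simp [Function.onFun, h, h', hd hij]
  · intro j
    by_cases h : j ∈ S <;> simp [h, hD j]

theorem summable_real_of_disjoint (ν : Measure X) [IsFiniteMeasure ν] {D : ℕ → Set X}
    (hD : ∀ j, MeasurableSet (D j)) (hd : Pairwise fun i j => Disjoint (D i) (D j)) :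
    Summable fun j => ν.real (D j) := by
  refine ENNReal.summable_toReal ?_
  rw [← measure_iUnion hd hD]
  exact measure_ne_top _ _

/-- Setwise convergence of finite measures is uniform on the unions of the members of some tail of
a disjoint sequence. -/
theorem exists_tail_uniform_measure {ν : ℕ → Measure X} [∀ n, IsFiniteMeasure (ν n)]
    {μ : Set X → ℝ} (h : ∀ E, MeasurableSet E → Tendsto (fun n => (ν n).real E) atTop (𝓝 (μ E)))
    {D : ℕ → Set X} (hD : ∀ j, MeasurableSet (D j)) (hd : Pairwise fun i j => Disjoint (D i) (D j))
    {ε : ℝ} (hε : 0 < ε) :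
    ∃ K N : ℕ, ∀ k ≥ K, ∀ n ≥ N, |(ν n).real (⋃ j ≥ k, D j) - μ (⋃ j ≥ k, D j)| ≤ ε := by
  obtain ⟨K, N, hKN⟩ := exists_tail_uniform (w := fun n j => (ν n).real (D j))
    (L := fun S => μ (⋃ j ∈ S, D j)) (fun _ _ => measureReal_nonneg)
    (fun n => summable_real_of_disjoint (ν n) hD hd)
    (fun S => by
      simp only [← real_iUnion_eq_tsum _ hD hd]
      exact h _ (MeasurableSet.biUnion (Set.to_countable S) fun j _ => hD j)) hε
  refine ⟨K, N, fun k hk n hn => ?_⟩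
  have := hKN {j | k ≤ j} (fun j hj => hk.trans hj) n hn
  rw [← real_iUnion_eq_tsum _ hD hd] at this
  exact this

theorem tendsto_real_iInter_zero (ν : Measure X) [IsFiniteMeasure ν] {G : ℕ → Set X}
    (hG : ∀ k, MeasurableSet (G k)) (ha : Antitone G) (hi : ⋂ k, G k = ∅) :
    Tendsto (fun k => ν.real (G k)) atTop (𝓝 0) := by
  have := tendsto_measure_iInter_atTop (μ := ν) (fun k => (hG k).nullMeasurableSet) ha
    ⟨0, measure_ne_top _ _⟩
  rw [hi, measure_empty] at this
  exact (ENNReal.tendsto_toReal ENNReal.zero_ne_top).comp this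

theorem antitone_tail {Y : Type*} (D : ℕ → Set Y) : Antitone fun k => ⋃ j ≥ k, D j :=
  fun _ _ h => Set.biUnion_subset_biUnion_left fun _ hj => le_trans h hj

theorem iInter_tail_eq_empty {Y : Type*} {D : ℕ → Set Y} (hd : Pairwise fun i j => Disjoint (D i) (D j)) :
    ⋂ k, ⋃ j ≥ k, D j = ∅ := by
  refine Set.eq_empty_of_forall_notMem fun x hx => ?_
  rw [Set.mem_iInter] at hx
  obtain ⟨i, _, hi⟩ := Set.mem_iUnion₂.1 (hx 0)
  obtain ⟨j, hj, hj'⟩ := Set.mem_iUnion₂.1 (hx (i + 1))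
  exact Set.disjoint_left.1 (hd (by have : i + 1 ≤ j := hj; omega : i ≠ j)) hi hj'

theorem measurableSet_tail {D : ℕ → Set X} (hD : ∀ j, MeasurableSet (D j)) (k : ℕ) :
    MeasurableSet (⋃ j ≥ k, D j) :=
  MeasurableSet.biUnion (Set.to_countable {j | k ≤ j}) fun j _ => hD j

/-- Continuity at `∅` along tails of disjoint sequences gives countable additivity. -/
theorem mem_ca_of_tendsto_tail {η : SetFun X} (hη : η ∈ Sba X)
    (h : ∀ D : ℕ → Set X, ∀ hD : ∀ j, MeasurableSet (D j),
      Pairwise (fun i j => Disjoint (D i) (D j)) →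
      Tendsto (fun k => η ⟨⋃ j ≥ k, D j, measurableSet_tail hD k⟩) atTop (𝓝 0)) : η ∈ ca X := by
  refine ⟨hη.1, fun E hE => ?_⟩
  have ht := h (fun n => (E n : Set X)) (fun n => (E n).2) hE
  rw [hasSum_iff_tendsto_nat_of_nonneg (fun n => hη.2.1 _)]
  have key : ∀ k, ∑ n ∈ Finset.range k, η (E n) =
      η ⟨⋃ n, (E n : Set X), MeasurableSet.iUnion fun n => (E n).2⟩ -
      η ⟨⋃ j ≥ k, (E j : Set X), measurableSet_tail (fun n => (E n).2) k⟩ := by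
    intro k
    induction k with
    | zero => simp
    | succ k ih =>
      rw [Finset.sum_range_succ, ih]
      have := hη.1.2.1 (E k) ⟨⋃ j ≥ k + 1, (E j : Set X), measurableSet_tail (fun n => (E n).2) _⟩ (by
        refine Set.disjoint_iUnion₂_right.2 fun j hj => hE ?_
        have : k + 1 ≤ j := hj
        omega)
      have h2 : (⟨⋃ j ≥ k, (E j : Set X), measurableSet_tail (fun n => (E n).2) k⟩ : MSet X) =
          ⟨(E k : Set X) ∪ ⋃ j ≥ k + 1, (E j : Set X),
            (E k).2.union (measurableSet_tail (fun n => (E n).2) _)⟩ := by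
        refine Subtype.ext (Set.ext fun x => ?_)
        simp only [Set.mem_iUnion, Set.mem_union]
        constructor
        · rintro ⟨j, hj, hx⟩
          rcases eq_or_lt_of_le (show k ≤ j from hj) with rfl | hlt
          · exact Or.inl hx
          · exact Or.inr ⟨j, hlt, hx⟩
        · rintro (hx | ⟨j, hj, hx⟩)
          · exact ⟨k, le_refl k, hx⟩
          · exact ⟨j, (Nat.le_succ k).trans hj, hx⟩
      rw [h2, this]
      ring
  simp only [key]
  simpa using ht.const_sub
    (η ⟨⋃ n, (E n : Set X), MeasurableSet.iUnion fun n => (E n).2⟩)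

/-- A countably additive member of `Sba` is a probability measure. -/
theorem exists_measure_of_mem_ca {η : SetFun X} (hη : η ∈ Sba X) (hc : η ∈ ca X) :
    ∃ ν : Measure X, IsProbabilityMeasure ν ∧ ∀ E : MSet X, ν.real E = η E := by
  let ν : Measure X := Measure.ofMeasurable (fun E hE => ENNReal.ofReal (η ⟨E, hE⟩))
    (by rw [hη.1.1, ENNReal.ofReal_zero]) (by
      intro f hf hd
      have := hc.2 (fun n => ⟨f n, hf n⟩) hd
      rw [← ENNReal.ofReal_tsum_of_nonneg (fun n => hη.2.1 _) this.summable, this.tsum_eq])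
  have hν : ∀ E : MSet X, ν E = ENNReal.ofReal (η E) := fun E => Measure.ofMeasurable_apply _ E.2
  refine ⟨ν, ⟨?_⟩, fun E => ?_⟩
  · have := hν ⟨Set.univ, MeasurableSet.univ⟩
    rw [hη.2.2] at this
    simpa using this
  · rw [measureReal_def, hν, ENNReal.toReal_ofReal (hη.2.1 E)]

/-- The set function of a measure. -/
noncomputable def ofMeasure (ν : Measure X) : SetFun X := fun E => ν.real E

theorem ofMeasure_eq (ν : Measure X) : ofMeasure ν = toSetFun (fun f => ∫ x, f x ∂ν) :=
  funext fun E => (integral_indicator_one E.2).symm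

theorem ofMeasure_mem (ν : Measure X) [IsProbabilityMeasure ν] : ofMeasure ν ∈ Sba X := by
  rw [ofMeasure_eq]
  exact (isMean_integral ν).toSetFun_mem

theorem faIntegral_ofMeasure (ν : Measure X) [IsProbabilityMeasure ν] {f : X → ℝ} (hf : Bdd f) :
    faIntegral (ofMeasure ν) f = ∫ x, f x ∂ν := by
  rw [ofMeasure_eq]
  exact (isMean_integral ν).faIntegral_toSetFun hf

theorem IsMean.exists_measure {Φ : (X → ℝ) → ℝ} (h : IsMean Φ) (hc : toSetFun Φ ∈ ca X) :
    ∃ ν : Measure X, IsProbabilityMeasure ν ∧ ∀ f, Bdd f → ∫ x, f x ∂ν = Φ f := by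
  obtain ⟨ν, hν, hE⟩ := exists_measure_of_mem_ca h.toSetFun_mem hc
  refine ⟨ν, hν, fun f hf => ?_⟩
  rw [← faIntegral_ofMeasure ν hf, show ofMeasure ν = toSetFun Φ from funext hE,
    h.faIntegral_toSetFun hf]

/-- The Cesàro averages of the transition probabilities started at a point. -/
theorem exists_cesaro_measure (κ : Kernel X X) [IsMarkovKernel κ] {n : ℕ} (hn : n ≠ 0) (x : X) :
    ∃ ν : Measure X, IsProbabilityMeasure ν ∧ ∀ f, Bdd f → ∫ y, f y ∂ν = cesaroAct κ n f x := by
  refine (isMean_cesaroAct κ hn x).exists_measure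
    (mem_ca_of_tendsto_tail (isMean_cesaroAct κ hn x).toSetFun_mem fun D hD hd => ?_)
  simp only [toSetFun, cesaroAct_apply]
  rw [← mul_zero (1 / (n : ℝ)), ← Finset.sum_const_zero (s := Finset.Icc 1 n)]
  refine (tendsto_finsetSum _ fun k _ => ?_).const_mul _
  simp only [act_indicator _ (measurableSet_tail hD _)]
  exact tendsto_real_iInter_zero _ (measurableSet_tail hD) (antitone_tail D)
    (iInter_tail_eq_empty hd)

theorem nonempty_of_mem_Sba {η : SetFun X} (hη : η ∈ Sba X) : Nonempty X := by
  by_contra h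
  rw [not_nonempty_iff] at h
  have h1 := hη.2.2
  have h2 : (⟨Set.univ, MeasurableSet.univ⟩ : MSet X) = ⟨∅, MeasurableSet.empty⟩ :=
    Subtype.ext (Set.univ_eq_empty_iff.2 h)
  rw [h2, hη.1.1] at h1
  exact zero_ne_one h1

/-- A setwise limit of finite measures is countably additive. -/
theorem mem_ca_of_tendsto {η : SetFun X} (hη : η ∈ Sba X) {ν : ℕ → Measure X}
    [∀ n, IsFiniteMeasure (ν n)]
    (h : ∀ E : MSet X, Tendsto (fun n => (ν n).real E) atTop (𝓝 (η E))) : η ∈ ca X := by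
  classical
  refine mem_ca_of_tendsto_tail hη fun D hD hd => ?_
  let μ : Set X → ℝ := fun E => if hE : MeasurableSet E then η ⟨E, hE⟩ else 0
  have hμ : ∀ E (hE : MeasurableSet E), μ E = η ⟨E, hE⟩ := fun E hE => by simp [μ, hE]
  rw [Metric.tendsto_atTop]
  intro ε hε
  -- The cutoff `K` serves all tails at once, so the single measure `ν N`, which is continuous at
  -- `∅`, controls the tails of `η`.
  obtain ⟨K, N, hKN⟩ := exists_tail_uniform_measure (ν := ν) (μ := μ)
    (fun E hE => by rw [hμ E hE]; exact h ⟨E, hE⟩) hD hd (half_pos hε)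
  have h1 := tendsto_real_iInter_zero (ν N) (measurableSet_tail hD) (antitone_tail D)
    (iInter_tail_eq_empty hd)
  obtain ⟨K', hK'⟩ := eventually_atTop.1 (h1.eventually (gt_mem_nhds (half_pos hε)))
  refine ⟨max K K', fun k hk => ?_⟩
  have h2 := hKN k (le_of_max_le_left hk) N le_rfl
  have h3 := hK' k (le_of_max_le_right hk)
  rw [hμ _ (measurableSet_tail hD k)] at h2
  rw [Real.dist_eq, sub_zero, abs_of_nonneg (hη.2.1 _)]
  linarith [(abs_le.1 h2).1]

/-- The averages started at any one point are countably additive and converge setwise to `μ`. -/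
theorem invariant_mem_ca (κ : Kernel X X) [IsMarkovKernel κ] {μ : SetFun X} (hμ : Dba κ = {μ}) :
    μ ∈ ca X := by
  have hμS : μ ∈ Sba X := (hμ.ge rfl : μ ∈ Dba κ).1
  obtain ⟨x⟩ := nonempty_of_mem_Sba hμS
  choose ν hν hνi using fun n : ℕ => exists_cesaro_measure κ (Nat.succ_ne_zero n) x
  refine mem_ca_of_tendsto hμS (ν := ν) fun E => ?_
  have hb := Bdd.indicator E.2
  have h1 : ∀ n, (ν n).real E = cesaroAct κ (n + 1) ((E : Set X).indicator 1) x := fun n => by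
    rw [← hνi n _ hb, integral_indicator_one E.2]
  simp only [h1]
  rw [← faIntegral_indicator hμS.1 E, Metric.tendsto_atTop]
  intro ε hε
  obtain ⟨N, hN⟩ := cesaroAct_uniform κ hμ hb (half_pos hε)
  exact ⟨N, fun n hn => (hN (n + 1) (by omega) x).trans_lt (half_lt_self hε)⟩

/-! ### Uniform absolute continuity of the transition probabilities. -/

/-- The Cesàro averages of the chain converge uniformly to the mean of the invariant
probability measure `m`. -/
structure UniformCesaro (κ : Kernel X X) (m : Measure X) : Prop where
  inv : ∀ f, Bdd f → ∫ x, act κ f x ∂m = ∫ x, f x ∂m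
  conv : ∀ f, Bdd f → ∀ ε > 0, ∃ N : ℕ, ∀ n ≥ N, ∀ x, |cesaroAct κ n f x - ∫ x, f x ∂m| ≤ ε

/-- Borel–Cantelli, followed by continuity from above. -/
theorem exists_null_limsup (m : Measure X) [IsFiniteMeasure m] {E : ℕ → Set X}
    (hE : ∀ j, MeasurableSet (E j)) (hm : ∀ j, m.real (E j) ≤ (1 / 2) ^ j) :
    m (⋂ k, ⋃ j ≥ k, E j) = 0 ∧ Tendsto (fun k => m.real (⋃ j ≥ k, E j)) atTop (𝓝 0) := by
  have h1 : m (limsup E atTop) = 0 := by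
    refine measure_limsup_atTop_eq_zero (ne_of_lt (lt_of_le_of_lt (ENNReal.tsum_le_tsum
      (g := fun j => ENNReal.ofReal ((1 / 2) ^ j)) fun j => ?_) ?_))
    · rw [← ofReal_measureReal]
      exact ENNReal.ofReal_le_ofReal (hm j)
    · rw [← ENNReal.ofReal_tsum_of_nonneg (fun j => by positivity) summable_geometric_two]
      exact ENNReal.ofReal_lt_top
  rw [limsup_eq_iInf_iSup_of_nat] at h1
  have h1' : m (⋂ k, ⋃ j ≥ k, E j) = 0 := h1
  refine ⟨h1', ?_⟩
  have := tendsto_measure_iInter_atTop (μ := m)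
    (fun k => (measurableSet_tail hE k).nullMeasurableSet) (antitone_tail E)
    ⟨0, measure_ne_top _ _⟩
  rw [h1'] at this
  exact (ENNReal.tendsto_toReal ENNReal.zero_ne_top).comp this

/-- A Vitali–Hahn–Saks argument. Failure gives sets `E j` of measure at most `2⁻ʲ` charged more than
`δ` by averages started at points `x j`. Uniformity in the starting point makes these averages
converge setwise to `m` although the points vary. -/
theorem UniformCesaro.cesaro_uac {κ : Kernel X X} [IsMarkovKernel κ] {m : Measure X}
    [IsProbabilityMeasure m] (h : UniformCesaro κ m) {δ : ℝ} (hδ : 0 < δ) :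
    ∃ n : ℕ, n ≠ 0 ∧ ∃ ε > 0, ∀ x, ∀ E : Set X, MeasurableSet E → m.real E ≤ ε →
      cesaroAct κ n (E.indicator 1) x ≤ δ := by
  by_contra! hcon
  choose x E hE hmE hx using fun j : ℕ =>
    hcon (j + 1) (Nat.succ_ne_zero j) ((1 / 2) ^ j) (by positivity)
  choose ν hν hνi using fun j : ℕ => exists_cesaro_measure κ (Nat.succ_ne_zero j) (x j)
  have hνE : ∀ j F, MeasurableSet F → (ν j).real F = cesaroAct κ (j + 1) (F.indicator 1) (x j) :=
    fun j F hF => by rw [← hνi j _ (Bdd.indicator hF), integral_indicator_one hF]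
  have hconv : ∀ F, MeasurableSet F → Tendsto (fun j => (ν j).real F) atTop (𝓝 (m.real F)) := by
    intro F hF
    rw [Metric.tendsto_atTop]
    intro ε hε
    obtain ⟨N, hN⟩ := h.conv _ (Bdd.indicator hF) (ε / 2) (half_pos hε)
    refine ⟨N, fun n hn => ?_⟩
    have := hN (n + 1) (by omega) (x n)
    rw [integral_indicator_one hF, ← hνE n F hF] at this
    exact this.trans_lt (half_lt_self hε)
  set G : ℕ → Set X := fun k => ⋃ j ≥ k, E j with hG
  have hGm : ∀ k, MeasurableSet (G k) := measurableSet_tail hE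
  have hGa : Antitone G := antitone_tail E
  obtain ⟨hnull, hlim⟩ := exists_null_limsup m hE hmE
  set G' : Set X := ⋂ k, G k with hG'
  have hG'm : MeasurableSet G' := MeasurableSet.iInter hGm
  -- The Nikodym theorem needs disjoint sets. The tail `G k` splits into the `D j` with `j ≥ k` and
  -- the null set `G'`, on which setwise convergence is enough.
  let D : ℕ → Set X := fun k => G k \ G (k + 1)
  have hDd : Pairwise fun i j => Disjoint (D i) (D j) := by
    have : ∀ i j, i < j → Disjoint (D i) (D j) := fun i j hij =>
      Set.disjoint_left.2 fun y hy hy' => hy.2 (hGa hij hy'.1)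
    intro i j hij
    rcases lt_or_gt_of_ne hij with h | h
    exacts [this i j h, (this j i h).symm]
  have hcover : ∀ k, G k ⊆ (⋃ j ≥ k, D j) ∪ G' := by
    intro k y hy
    by_cases hyG : y ∈ G'
    · exact Or.inr hyG
    · left
      have hex : ∃ i, y ∉ G (k + i) := by
        rw [hG', Set.mem_iInter, not_forall] at hyG
        obtain ⟨i, hi⟩ := hyG
        exact ⟨i, fun hc => hi (hGa (by omega) hc)⟩
      classical
      have h1 := Nat.find_spec hex
      have h0 : Nat.find hex ≠ 0 := fun h0 => by
        rw [h0] at h1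
        exact h1 hy
      obtain ⟨i, hi⟩ := Nat.exists_eq_succ_of_ne_zero h0
      have h2 := Nat.find_min hex (m := i) (by omega)
      rw [hi] at h1
      exact Set.mem_iUnion₂.2 ⟨k + i, Nat.le_add_right k i, not_not.1 h2, h1⟩
  have hsub : ∀ k, (⋃ j ≥ k, D j) ⊆ G k := fun k =>
    Set.iUnion₂_subset fun j hj => Set.sdiff_subset.trans (hGa hj)
  obtain ⟨K, N, hKN⟩ := exists_tail_uniform_measure hconv
    (fun k => (hGm k).diff (hGm (k + 1))) hDd (by positivity : 0 < δ / 4)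
  obtain ⟨k, hkK, hk⟩ := ((eventually_ge_atTop K).and
    (hlim.eventually (gt_mem_nhds (by positivity : 0 < δ / 4)))).exists
  have h0 := hconv G' hG'm
  rw [measureReal_def m, hnull, ENNReal.toReal_zero] at h0
  obtain ⟨n, ⟨hn1, hn2⟩, hn3⟩ := (((eventually_ge_atTop N).and (eventually_ge_atTop k)).and
    (h0.eventually (gt_mem_nhds (by positivity : 0 < δ / 4)))).exists
  have h1 := hKN k hkK n hn1
  have h2 := hx n
  rw [← hνE n _ (hE n)] at h2
  -- As `n ≥ k`, the set `E n` lies in `G k`. The bounds `m (G k) < δ / 4`, the Nikodym error `δ /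
  -- 4` and `ν n G' < δ / 4` contradict `ν n (E n) > δ`.
  have h3 : (ν n).real (E n) ≤ (ν n).real ((⋃ j ≥ k, D j) ∪ G') :=
    measureReal_mono ((Set.subset_iUnion₂_of_subset n hn2 subset_rfl).trans (hcover k))
  have h4 := measureReal_union_le (μ := ν n) (⋃ j ≥ k, D j) G'
  have h5 : m.real (⋃ j ≥ k, D j) ≤ m.real (G k) := measureReal_mono (hsub k) (measure_ne_top _ _)
  have h6 := (abs_le.1 h1).2
  change m.real (G k) < δ / 4 at hk
  linarith

theorem UniformCesaro.inv_pow {κ : Kernel X X} [IsMarkovKernel κ] {m : Measure X}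
    (h : UniformCesaro κ m) (n : ℕ) {f : X → ℝ} (hf : Bdd f) :
    ∫ x, act (κ ^ n) f x ∂m = ∫ x, f x ∂m := by
  induction n generalizing f with
  | zero => rw [act_pow_zero κ hf]
  | succ n ih => rw [add_comm, act_pow_add κ 1 n hf, act_pow_one, ih (hf.act κ), h.inv f hf]

/-- The `n`-step transition probabilities are uniformly absolutely continuous, up to `δ`, with
respect to the invariant measure once `n` is large. -/
theorem UniformCesaro.uac {κ : Kernel X X} [IsMarkovKernel κ] {m : Measure X}
    [IsProbabilityMeasure m] (h : UniformCesaro κ m) {δ : ℝ} (hδ : 0 < δ) :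
    ∃ n : ℕ, ∃ ε > 0, ∀ n' ≥ n, ∀ x, ∀ E : Set X, MeasurableSet E → m.real E ≤ ε →
      ((κ ^ n') x).real E ≤ δ := by
  -- One power suffices: later ones apply a further averaging operator, which preserves upper
  -- bounds.
  suffices hs : ∃ n : ℕ, ∃ ε > 0, ∀ x, ∀ E : Set X, MeasurableSet E → m.real E ≤ ε →
      act (κ ^ n) (E.indicator 1) x ≤ δ by
    obtain ⟨n, ε, hε, hn⟩ := hs
    refine ⟨n, ε, hε, fun n' hn' x E hE hmE => ?_⟩
    obtain ⟨j, rfl⟩ := Nat.exists_eq_add_of_le hn'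
    rw [← act_indicator _ hE, act_pow_add κ n j (Bdd.indicator hE), ← (isMean_act (κ ^ j) x).const δ]
    exact (isMean_act (κ ^ j) x).mono ((Bdd.indicator hE).act _) (Bdd.const δ)
      fun y => hn y E hE hmE
  obtain ⟨n, hn0, ε, hε, hn⟩ := h.cesaro_uac (half_pos hδ)
  have hnpos : (0 : ℝ) < n := by exact_mod_cast Nat.pos_of_ne_zero hn0
  -- The bound `ε / n` lets `n` exceptional sets of measure at most `t` have total measure at most
  -- `ε`; the bound `δ / 2` absorbs the loss off these sets.
  set t : ℝ := min (δ / 2) (ε / n) with ht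
  have htpos : 0 < t := lt_min (half_pos hδ) (by positivity)
  refine ⟨n, t * t, by positivity, fun x E hE hmE => ?_⟩
  have hb := Bdd.indicator (X := X) hE
  have hb0 : ∀ y, 0 ≤ E.indicator (1 : X → ℝ) y := fun y =>
    Set.indicator_nonneg (fun _ _ => zero_le_one) y
  -- `F k` collects the points from which `E` is reached in the remaining `n - k` steps with
  -- probability at least `t`. By Markov's inequality and invariance, `t * m (F k) ≤ m E ≤ t * t`.
  let F : ℕ → Set X := fun k => {y | t ≤ act (κ ^ (n - k)) (E.indicator 1) y}
  have hF : ∀ k, MeasurableSet (F k) := fun k => measurableSet_le measurable_const (hb.act _).1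
  have hFm : ∀ k, m.real (F k) ≤ t := by
    intro k
    have h1 := mul_meas_ge_le_integral_of_nonneg (μ := m)
      (.of_forall fun y => (isMean_act (κ ^ (n - k)) y).nonneg _ hb hb0)
      ((hb.act (κ ^ (n - k))).integrable m) t
    rw [h.inv_pow _ hb, integral_indicator_one hE] at h1
    exact le_of_mul_le_mul_left (h1.trans hmE) htpos
  let G : Set X := ⋃ k ∈ Finset.Icc 1 n, F k
  have hG : MeasurableSet G := Finset.measurableSet_biUnion _ fun k _ => hF k
  have hGm : m.real G ≤ ε := by
    refine (measureReal_biUnion_finset_le _ _).trans ((Finset.sum_le_sum fun k _ => hFm k).trans ?_)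
    rw [Finset.sum_const, Nat.card_Icc, nsmul_eq_mul, Nat.add_sub_cancel]
    calc (n : ℝ) * t ≤ n * (ε / n) := mul_le_mul_of_nonneg_left (min_le_right _ _) hnpos.le
      _ = ε := by field_simp
  have h1 := hn x G hG hGm
  rw [cesaroAct_apply] at h1
  have hGb := Bdd.indicator (X := X) hG
  -- To reach `E` at time `n`, the chain either is in `G` at time `k` or has chance less than `t`
  -- from there. Averaging over `k` brings in the Cesàro bound for `G`.
  have h2 : ∀ k ∈ Finset.Icc 1 n, act (κ ^ n) (E.indicator 1) x - t ≤
      act (κ ^ k) (G.indicator 1) x := by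
    intro k hk
    have hkn : n = (n - k) + k := (Nat.sub_add_cancel (Finset.mem_Icc.1 hk).2).symm
    have hm := isMean_act (κ ^ k) x
    have e1 : act (κ ^ n) (E.indicator 1) x =
        act (κ ^ k) (act (κ ^ (n - k)) (E.indicator 1)) x := by
      conv_lhs => rw [hkn, act_pow_add κ (n - k) k hb]
    have e2 : act (κ ^ k) (G.indicator 1 + fun _ => t) x = act (κ ^ k) (G.indicator 1) x + t :=
      (hm.add _ _ hGb (Bdd.const t)).trans (congrArg _ (hm.const t))
    rw [e1, sub_le_iff_le_add, ← e2]
    refine hm.mono (hb.act _) (hGb.add (Bdd.const t)) fun y => ?_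
    by_cases hy : y ∈ G
    · have := (abs_le.1 (abs_act_le (κ ^ (n - k)) hb (C := 1) (fun z => by
        by_cases hz : z ∈ E <;> simp [hz]) y)).2
      simp only [Pi.add_apply, Set.indicator_of_mem hy, Pi.one_apply]
      linarith
    · have : ¬ t ≤ act (κ ^ (n - k)) (E.indicator 1) y := fun hc =>
        hy (Set.mem_biUnion (show k ∈ (Finset.Icc 1 n : Set ℕ) by exact_mod_cast hk) hc)
      simp only [Pi.add_apply, Set.indicator_of_notMem hy, zero_add]
      exact (not_le.1 this).le
  have h3 := Finset.sum_le_sum h2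
  rw [Finset.sum_const, Nat.card_Icc, nsmul_eq_mul, Nat.add_sub_cancel] at h3
  have h4 : act (κ ^ n) (E.indicator 1) x - t ≤ δ / 2 := by
    refine le_trans ?_ h1
    rw [one_div, ← div_eq_inv_mul, le_div_iff₀ hnpos]
    linarith
  have h5 : t ≤ δ / 2 := min_le_left _ _
  linarith

/-! ### Quasi-compactness. -/

/-- Bounded sequences in a Hilbert space have weakly Cauchy subsequences. -/
theorem exists_subseq_inner_cauchy {H : Type*} [NormedAddCommGroup H] [InnerProductSpace ℝ H]
    [CompleteSpace H] (f : ℕ → H) {C : ℝ} (hC : ∀ j, ‖f j‖ ≤ C) :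
    ∃ φ : ℕ → ℕ, StrictMono φ ∧ ∀ g : H, CauchySeq fun j => inner ℝ g (f (φ j)) := by
  have hC0 : 0 ≤ C := (norm_nonneg _).trans (hC 0)
  have hK : IsCompact (Set.univ.pi fun _ : ℕ => Set.Icc (-(C * C)) (C * C)) :=
    isCompact_univ_pi fun _ => isCompact_Icc
  -- Compactness of a countable product replaces the diagonal argument: along `φ` the products with
  -- every `f i` converge.
  obtain ⟨a, _, φ, hφ, ha⟩ := hK.tendsto_subseq (x := fun j i => inner ℝ (f i) (f j))
    (fun j i _ => abs_le.1 ((abs_real_inner_le_norm _ _).trans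
      (mul_le_mul (hC i) (hC j) (norm_nonneg _) hC0)))
  refine ⟨φ, hφ, ?_⟩
  let V : Submodule ℝ H :=
    { carrier := {g | CauchySeq fun j => inner ℝ g (f (φ j))}
      add_mem' := fun {a b} ha hb => by
        simp only [Set.mem_ofPred_eq, inner_add_left] at *
        exact ha.add hb
      zero_mem' := by
        simp only [Set.mem_ofPred_eq, inner_zero_left]
        exact cauchySeq_const 0
      smul_mem' := fun c a ha => by
        simp only [Set.mem_ofPred_eq, real_inner_smul_left] at *
        exact (uniformContinuous_const_smul c).comp_cauchySeq ha }
  have hVc : IsClosed (V : Set H) := by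
    refine isClosed_of_closure_subset fun g hg => ?_
    change CauchySeq fun j => inner ℝ g (f (φ j))
    rw [Metric.cauchySeq_iff]
    intro ε hε
    obtain ⟨g', hg', hd⟩ := Metric.mem_closure_iff.1 hg (ε / (3 * (C + 1))) (by positivity)
    obtain ⟨N, hN⟩ := Metric.cauchySeq_iff.1 (show CauchySeq fun j => inner ℝ g' (f (φ j)) from hg')
      (ε / 3) (by positivity)
    have hb : ∀ j, |inner ℝ g (f (φ j)) - inner ℝ g' (f (φ j))| < ε / 3 := by
      intro j
      rw [← inner_sub_left]
      refine (abs_real_inner_le_norm _ _).trans_lt ?_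
      rw [dist_eq_norm, lt_div_iff₀ (by positivity)] at hd
      have := mul_le_mul_of_nonneg_left (hC (φ j)) (norm_nonneg (g - g'))
      nlinarith [norm_nonneg (g - g')]
    refine ⟨N, fun i hi j hj => ?_⟩
    have h1 := abs_lt.1 (hb i)
    have h2 := abs_lt.1 (hb j)
    have h3 := hN i hi j hj
    rw [Real.dist_eq, abs_lt] at *
    constructor <;> linarith [h3.1, h3.2]
  -- `V` is closed and contains every `f i`. A vector orthogonal to `V` has zero product with each
  -- `f i`, so it lies in `V` too and vanishes.
  have hV : V = ⊤ := by
    have : CompleteSpace V := hVc.completeSpace_coe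
    rw [← Submodule.orthogonal_eq_bot_iff, Submodule.eq_bot_iff]
    intro q hq
    have hf : ∀ i, f i ∈ V := fun i => ((tendsto_pi_nhds.1 ha) i).cauchySeq
    have hqV : q ∈ V := by
      change CauchySeq fun j => inner ℝ q (f (φ j))
      have : (fun j => inner ℝ q (f (φ j))) = fun _ => (0 : ℝ) :=
        funext fun j => (Submodule.mem_orthogonal' V q).1 hq _ (hf _)
      rw [this]
      exact cauchySeq_const 0
    exact inner_self_eq_zero.1 ((Submodule.mem_orthogonal V q).1 hq q hqV)
  intro g
  have : g ∈ V := hV ▸ Submodule.mem_top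
  exact this

/-- Measurable functions with values in `[-1, 1]`. -/
def UnitBdd (f : X → ℝ) : Prop := Measurable f ∧ ∀ x, |f x| ≤ 1

theorem UnitBdd.bdd {f : X → ℝ} (hf : UnitBdd f) : Bdd f := .of_unit hf.1 hf.2

theorem UnitBdd.act {f : X → ℝ} (hf : UnitBdd f) (κ : Kernel X X) [IsMarkovKernel κ] :
    UnitBdd (act κ f) :=
  ⟨(hf.bdd.act κ).1, abs_act_le κ hf.bdd hf.2⟩

theorem UnitBdd.indicator {E : Set X} (hE : MeasurableSet E) :
    UnitBdd (E.indicator (1 : X → ℝ)) :=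
  ⟨(Bdd.indicator hE).1, fun x => by by_cases h : x ∈ E <;> simp [h]⟩

theorem Bdd.memLp {f : X → ℝ} (hf : Bdd f) (m : Measure X) [IsFiniteMeasure m] : MemLp f 2 m := by
  obtain ⟨hf, C, hC⟩ := hf
  exact MemLp.of_bound hf.aestronglyMeasurable C (.of_forall hC)

theorem exists_subseq_integral_cauchy (m : Measure X) [IsProbabilityMeasure m] {f : ℕ → X → ℝ}
    (hf : ∀ j, UnitBdd (f j)) :
    ∃ φ : ℕ → ℕ, StrictMono φ ∧ ∀ g, Bdd g → CauchySeq fun j => ∫ x, g x * f (φ j) x ∂m := by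
  obtain ⟨φ, hφ, h⟩ := exists_subseq_inner_cauchy (fun j => ((hf j).bdd.memLp m).toLp (f j))
    (C := 1) (fun j => by
      rw [Lp.norm_toLp]
      refine ENNReal.toReal_le_of_le_ofReal zero_le_one ?_
      refine (eLpNorm_le_of_ae_bound (C := 1) (.of_forall (hf j).2)).trans ?_
      simp)
  refine ⟨φ, hφ, fun g hg => ?_⟩
  convert h ((hg.memLp m).toLp g) using 2 with j
  rw [L2.inner_def]
  refine integral_congr_ae ?_
  filter_upwards [(hg.memLp m).coeFn_toLp, ((hf (φ j)).bdd.memLp m).coeFn_toLp] with x h1 h2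
  rw [h1, h2]
  simp [mul_comm]

/-- A probability measure that is absolutely continuous up to `δ` has a bounded density
up to an error `δ`. -/
theorem exists_bdd_density (m ν : Measure X) [IsProbabilityMeasure m] [IsProbabilityMeasure ν]
    {ε δ : ℝ} (hε : 0 < ε) (h : ∀ E, MeasurableSet E → m.real E ≤ ε → ν.real E ≤ δ) :
    ∃ g, Bdd g ∧ ∀ u C, Bdd u → 0 ≤ C → (∀ x, |u x| ≤ C) →
      |∫ x, u x ∂ν - ∫ x, g x * u x ∂m| ≤ C * δ := by
  set c : ENNReal := ENNReal.ofReal (1 / ε) with hc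
  let ρ : Measure X := c • m
  have : IsFiniteMeasure ρ := Measure.smul_finite m ENNReal.ofReal_ne_top
  -- On `s` one has `ν ≤ m / ε`, which gives a density bounded by `1 / ε`. On the complement `m / ε
  -- ≤ ν`, so its `m`-measure is at most `ε` and its `ν`-measure at most `δ`.
  obtain ⟨s, hs⟩ := exists_isHahnDecomposition ν ρ
  have hsm := hs.measurableSet
  have h1 : m.real sᶜ ≤ ε := by
    have h2 : ρ sᶜ ≤ 1 := by
      have := hs.ge_on_compl sᶜ
      rw [Measure.restrict_apply_self, Measure.restrict_apply_self] at this
      exact this.trans prob_le_one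
    have h3 : ρ.real sᶜ = 1 / ε * m.real sᶜ := by
      simp only [ρ, measureReal_ennreal_smul_apply, hc]
      rw [ENNReal.toReal_ofReal (by positivity)]
    have h4 : ρ.real sᶜ ≤ 1 := ENNReal.toReal_le_of_le_ofReal zero_le_one (by simpa using h2)
    rw [h3, one_div, ← div_eq_inv_mul, div_le_one hε] at h4
    exact h4
  have h2 := h _ hsm.compl h1
  have hle : ν.restrict s ≤ ρ := hs.le_on.trans Measure.restrict_le_self
  have hac : ν.restrict s ≪ ρ := Measure.absolutelyContinuous_of_le hle
  have hr1 := Measure.rnDeriv_le_one_of_le hle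
  set r := (ν.restrict s).rnDeriv ρ with hr
  have hrm : Measurable r := Measure.measurable_rnDeriv _ _
  -- The minimum with `1` makes the bound hold everywhere; `r ≤ 1` is known only almost everywhere.
  refine ⟨fun x => 1 / ε * min (r x).toReal 1, ⟨(hrm.ennreal_toReal.min measurable_const).const_mul _,
    1 / ε, fun x => ?_⟩, fun u C hu hC0 hC => ?_⟩
  · rw [abs_mul, abs_of_nonneg (by positivity : 0 ≤ 1 / ε),
      abs_of_nonneg (le_min ENNReal.toReal_nonneg zero_le_one)]
    exact mul_le_of_le_one_right (by positivity) (min_le_right _ _)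
  · have e1 : ∫ x, 1 / ε * min (r x).toReal 1 * u x ∂m = ∫ x in s, u x ∂ν := by
      rw [← integral_rnDeriv_smul hac, integral_smul_measure, hc,
        ENNReal.toReal_ofReal (by positivity), smul_eq_mul, ← integral_const_mul]
      have hr2 : r ≤ᵐ[m] 1 := (Measure.absolutelyContinuous_smul (by
        rw [hc]; simpa using hε)).ae_le hr1
      refine integral_congr_ae ?_
      filter_upwards [hr2] with x hx
      have : (r x).toReal ≤ 1 := ENNReal.toReal_le_of_le_ofReal zero_le_one (by simpa using hx)
      rw [min_eq_left this, mul_assoc]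
      rfl
    rw [e1, ← integral_add_compl hsm (hu.integrable ν), add_sub_cancel_left]
    have := norm_setIntegral_le_of_norm_le_const (μ := ν) (s := sᶜ) (f := u) (C := C)
      (measure_lt_top _ _) (fun x _ => hC x)
    exact this.trans (mul_le_mul_of_nonneg_left h2 hC0)

/-- Quasi-compactness: no sequence in the unit ball is separated by a high power. -/
theorem UniformCesaro.exists_close {κ : Kernel X X} [IsMarkovKernel κ] {m : Measure X}
    [IsProbabilityMeasure m] (h : UniformCesaro κ m) {δ : ℝ} (hδ : 0 < δ) :
    ∃ N : ℕ, ∀ f : ℕ → X → ℝ, (∀ j, UnitBdd (f j)) →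
      ∃ i j, i < j ∧ ∀ x, |act (κ ^ N) (f i) x - act (κ ^ N) (f j) x| ≤ δ := by
  -- The budget is `3 * t` off an exceptional set and `2 * t` from it.
  set t := δ / 5 with ht
  have htpos : 0 < t := by positivity
  obtain ⟨n, ε, hε, hn⟩ := h.uac htpos
  -- The first `n` steps turn weak into approximate pointwise Cauchyness, through the bounded
  -- densities; the other `n` steps turn a small exceptional set for `m` into a small probability,
  -- uniformly in the starting point.
  refine ⟨n + n, fun f hf => ?_⟩
  obtain ⟨φ, hφ, hc⟩ := exists_subseq_integral_cauchy m hf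
  let u : ℕ → X → ℝ := fun j => act (κ ^ n) (f (φ j))
  have hu : ∀ j, UnitBdd (u j) := fun j => (hf _).act _
  have hpt : ∀ x, ∃ J, ∀ i ≥ J, ∀ j ≥ J, |u i x - u j x| ≤ 3 * t := by
    intro x
    obtain ⟨g, hg, hgu⟩ := exists_bdd_density m ((κ ^ n) x) hε (hn n le_rfl x)
    obtain ⟨J, hJ⟩ := Metric.cauchySeq_iff.1 (hc g hg) t htpos
    refine ⟨J, fun i hi j hj => ?_⟩
    have hfi := (hf (φ i)).bdd
    have hfj := (hf (φ j)).bdd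
    have h1 := hgu (f (φ i) - f (φ j)) 2 (hfi.sub hfj) zero_le_two fun y => by
      have h1 := abs_le.1 ((hf (φ i)).2 y)
      have h2 := abs_le.1 ((hf (φ j)).2 y)
      rw [abs_le]
      simp only [Pi.sub_apply]
      constructor <;> linarith
    have h2 := hJ i hi j hj
    have hgi : ∀ v, Bdd v → Integrable (fun y => g y * v y) m := by
      intro v hv
      obtain ⟨C, hC⟩ := hg.2
      exact (hv.integrable m).bdd_mul hg.1.aestronglyMeasurable (.of_forall hC)
    have e1 : ∫ y, (f (φ i) - f (φ j)) y ∂(κ ^ n) x = u i x - u j x :=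
      integral_sub (hfi.integrable _) (hfj.integrable _)
    have e2 : ∫ y, g y * (f (φ i) - f (φ j)) y ∂m =
        ∫ y, g y * f (φ i) y ∂m - ∫ y, g y * f (φ j) y ∂m := by
      rw [← integral_sub (hgi _ hfi) (hgi _ hfj)]
      exact integral_congr_ae (.of_forall fun y => mul_sub _ _ _)
    rw [e1, e2] at h1
    rw [Real.dist_eq] at h2
    have h1' := abs_le.1 h1
    have h2' := abs_lt.1 h2
    rw [abs_le]
    constructor <;> linarith [h1'.1, h1'.2, h2'.1, h2'.2]
  -- Egorov's argument: these sets decrease to `∅`, so some `G k` has measure below `ε`. On it the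
  -- difference is at most `2`.
  let G : ℕ → Set X := fun k => ⋃ i ≥ k, ⋃ j ≥ k, {x | 3 * t < |u i x - u j x|}
  have hGm : ∀ k, MeasurableSet (G k) := fun k =>
    measurableSet_tail (D := fun i => ⋃ j ≥ k, {x | 3 * t < |u i x - u j x|}) (fun i =>
      measurableSet_tail (D := fun j => {x | 3 * t < |u i x - u j x|}) (fun j =>
        measurableSet_lt measurable_const
          (continuous_abs.measurable.comp ((hu i).1.sub (hu j).1))) k) k
  have hGmem : ∀ k x, x ∈ G k ↔ ∃ i ≥ k, ∃ j ≥ k, 3 * t < |u i x - u j x| := fun k x => by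
    simp [G]
  have hGa : Antitone G := fun k k' hk x hx => by
    rw [hGmem] at *
    obtain ⟨i, hi, j, hj, hx⟩ := hx
    exact ⟨i, hk.trans hi, j, hk.trans hj, hx⟩
  have hGe : ⋂ k, G k = ∅ := by
    refine Set.eq_empty_of_forall_notMem fun x hx => ?_
    obtain ⟨J, hJ⟩ := hpt x
    obtain ⟨i, hi, j, hj, hlt⟩ := (hGmem J x).1 (Set.mem_iInter.1 hx J)
    exact absurd (hJ i hi j hj) (not_le.2 hlt)
  obtain ⟨k, hk⟩ := ((tendsto_real_iInter_zero m hGm hGa hGe).eventually (gt_mem_nhds hε)).exists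
  refine ⟨φ k, φ (k + 1), hφ (Nat.lt_succ_self k), fun x => ?_⟩
  rw [act_pow_add κ n n (hf _).bdd, act_pow_add κ n n (hf _).bdd]
  have hm := isMean_act (κ ^ n) x
  have hGb := Bdd.indicator (X := X) (hGm k)
  have hub : Bdd ((fun _ => 3 * t) + (2 : ℝ) • (G k).indicator (1 : X → ℝ)) :=
    (Bdd.const _).add (hGb.smul 2)
  have e : act (κ ^ n) ((fun _ => 3 * t) + (2 : ℝ) • (G k).indicator (1 : X → ℝ)) x ≤ δ := by
    have h1 := hn n le_rfl x (G k) (hGm k) hk.le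
    rw [← act_indicator _ (hGm k)] at h1
    have e1 := hm.add _ _ (Bdd.const (3 * t)) (hGb.smul 2)
    have e2 := hm.smul 2 _ hGb
    have e3 := hm.const (3 * t)
    rw [e1, e2, e3]
    linarith
  have hpw : ∀ y, |u k y - u (k + 1) y| ≤
      ((fun _ => 3 * t) + (2 : ℝ) • (G k).indicator (1 : X → ℝ) : X → ℝ) y := by
    intro y
    by_cases hy : y ∈ G k
    · have h1 := abs_le.1 ((hu k).2 y)
      have h2 := abs_le.1 ((hu (k + 1)).2 y)
      simp only [Pi.add_apply, Pi.smul_apply, Set.indicator_of_mem hy, Pi.one_apply, smul_eq_mul]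
      rw [abs_le]
      constructor <;> linarith [h1.1, h1.2, h2.1, h2.2]
    · simp only [Pi.add_apply, Pi.smul_apply, Set.indicator_of_notMem hy, smul_eq_mul, mul_zero,
        add_zero]
      by_contra hlt
      exact hy ((hGmem k y).2 ⟨k, le_rfl, k + 1, Nat.le_succ k, not_le.1 hlt⟩)
  have hs := (hu k).bdd.sub (hu (k + 1)).bdd
  have e4 := hm.sub (hu k).bdd (hu (k + 1)).bdd
  have e5 := hm.mono hs hub fun y => (le_abs_self _).trans (hpw y)
  have e6 := hm.mono ((hu (k + 1)).bdd.sub (hu k).bdd) hub fun y =>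
    (le_abs_self _).trans ((abs_sub_comm _ _).trans_le (hpw y))
  have e7 := hm.sub (hu (k + 1)).bdd (hu k).bdd
  change |act (κ ^ n) (u k) x - act (κ ^ n) (u (k + 1)) x| ≤ δ
  rw [abs_le]
  constructor <;> linarith

/-- Quasi-compactness: a high power maps the unit ball into a finite union of small balls. -/
theorem UniformCesaro.exists_net {κ : Kernel X X} [IsMarkovKernel κ] {m : Measure X}
    [IsProbabilityMeasure m] (h : UniformCesaro κ m) {δ : ℝ} (hδ : 0 < δ) :
    ∃ N : ℕ, ∃ s : Finset (X → ℝ), ∀ f, UnitBdd f →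
      ∃ g ∈ s, ∀ x, |act (κ ^ N) f x - act (κ ^ N) g x| ≤ δ := by
  obtain ⟨N, hN⟩ := h.exists_close hδ
  refine ⟨N, ?_⟩
  by_contra! hcon
  -- Without a finite net, a greedy choice produces a sequence whose images are `δ`-separated.
  obtain ⟨f, hf, hsep⟩ := exists_seq_of_forall_finset_exists (fun f : X → ℝ => UnitBdd f)
    (fun f g => ∃ x, δ < |act (κ ^ N) g x - act (κ ^ N) f x|) (fun s _ => hcon s)
  obtain ⟨i, j, hij, hx⟩ := hN f hf
  obtain ⟨x, hlt⟩ := hsep i j hij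
  rw [abs_sub_comm] at hlt
  exact absurd (hx x) (not_le.2 hlt)

/-! ### Limit kernels along ultrafilters. -/

/-- The powers of `κ` converge to `L` along `V`, uniformly on each bounded function. -/
def IsLimitKernel (κ L : Kernel X X) (V : Filter ℕ) : Prop :=
  ∀ f, Bdd f → ∀ ε > 0, ∀ᶠ n in V, ∀ x, |act (κ ^ n) f x - act L f x| ≤ ε

/-- For `n ≥ N` the function `act (κ ^ n) f` lies in one of finitely many small balls, and the
ultrafilter selects a single ball. So almost all these functions are uniformly close to each other,
hence to their pointwise limit. -/
theorem UniformCesaro.eventually_uniform {κ : Kernel X X} [IsMarkovKernel κ] {m : Measure X}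
    [IsProbabilityMeasure m] (h : UniformCesaro κ m) {V : Ultrafilter ℕ} (hV : (V : Filter ℕ) ≤ atTop)
    {Φ : X → (X → ℝ) → ℝ}
    (hl : ∀ x f, Bdd f → Tendsto (fun n => act (κ ^ n) f x) V (𝓝 (Φ x f)))
    (hΦ : ∀ x, IsMean (Φ x)) {f : X → ℝ} (hf : Bdd f) {ε : ℝ} (hε : 0 < ε) :
    ∀ᶠ n in V, ∀ x, |act (κ ^ n) f x - Φ x f| ≤ ε := by
  have unit : ∀ f, UnitBdd f → ∀ ε > 0, ∀ᶠ n in V, ∀ x, |act (κ ^ n) f x - Φ x f| ≤ ε := by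
    intro f hf ε hε
    obtain ⟨N, s, hs⟩ := h.exists_net (half_pos hε)
    have h1 : ∀ᶠ n in V, ∃ g ∈ (s : Set (X → ℝ)),
        ∀ x, |act (κ ^ n) f x - act (κ ^ N) g x| ≤ ε / 2 := by
      filter_upwards [hV (eventually_ge_atTop N)] with n hn
      obtain ⟨k, rfl⟩ := Nat.exists_eq_add_of_le' hn
      rw [act_pow_add κ k N hf.bdd]
      exact hs _ (hf.act _)
    obtain ⟨g, _, hg⟩ : ∃ g ∈ (s : Set (X → ℝ)),
        {n | ∀ x, |act (κ ^ n) f x - act (κ ^ N) g x| ≤ ε / 2} ∈ V := by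
      rw [← Ultrafilter.finite_biUnion_mem_iff s.finite_toSet]
      filter_upwards [h1] with n hn
      simpa using hn
    filter_upwards [hg] with n hn x
    refine le_of_tendsto ((hl x f hf.bdd).const_sub _).abs ?_
    filter_upwards [hg] with n' hn'
    have h2 := abs_le.1 (hn x)
    have h3 := abs_le.1 (hn' x)
    rw [abs_le]
    constructor <;> linarith [h2.1, h2.2, h3.1, h3.2]
  obtain ⟨C, hC⟩ := hf.2
  set D := |C| + 1
  have hD : 0 < D := by positivity
  have hu : UnitBdd (D⁻¹ • f) := by
    refine ⟨hf.1.const_smul _, fun x => ?_⟩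
    rw [Pi.smul_apply, smul_eq_mul, abs_mul, abs_of_pos (inv_pos.2 hD), ← div_eq_inv_mul,
      div_le_one hD]
    exact (hC x).trans ((le_abs_self C).trans (by simp [D]))
  filter_upwards [unit _ hu (ε / D) (by positivity)] with n hn x
  have h1 := hn x
  rw [(hΦ x).smul _ _ hf, (isMean_act (κ ^ n) x).smul _ _ hf, ← mul_sub, abs_mul,
    abs_of_pos (inv_pos.2 hD), ← div_eq_inv_mul, div_le_div_iff_of_pos_right hD] at h1
  exact h1

/-- Pointwise limits along `V` are a priori only means, with no measurability in `x`. Uniform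
absolute continuity makes them countably additive, and uniform convergence makes them limits of
sequences of measurable functions. -/
theorem UniformCesaro.exists_limitKernel {κ : Kernel X X} [IsMarkovKernel κ] {m : Measure X}
    [IsProbabilityMeasure m] (h : UniformCesaro κ m) {V : Ultrafilter ℕ}
    (hV : (V : Filter ℕ) ≤ atTop) :
    ∃ L : Kernel X X, IsMarkovKernel L ∧ IsLimitKernel κ L V := by
  choose Φ hΦ hl using fun x => exists_isMean_lim V (fun n => isMean_act (κ ^ n) x)
  have hca : ∀ x, toSetFun (Φ x) ∈ ca X := by
    intro x
    refine mem_ca_of_tendsto_tail (hΦ x).toSetFun_mem fun D hD hd => ?_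
    rw [Metric.tendsto_nhds]
    intro δ hδ
    obtain ⟨n, ε, hε, hn⟩ := h.uac (half_pos hδ)
    filter_upwards [(tendsto_real_iInter_zero m (measurableSet_tail hD) (antitone_tail D)
      (iInter_tail_eq_empty hd)).eventually (gt_mem_nhds hε)] with k hk
    rw [Real.dist_eq, sub_zero, abs_of_nonneg ((hΦ x).toSetFun_mem.2.1 _)]
    refine lt_of_le_of_lt ?_ (half_lt_self hδ)
    refine le_of_tendsto (hl x _ (Bdd.indicator (measurableSet_tail hD k))) ?_
    filter_upwards [hV (eventually_ge_atTop n)] with n' hn'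
    rw [act_indicator _ (measurableSet_tail hD k)]
    exact hn n' hn' x _ (measurableSet_tail hD k) hk.le
  choose ν hν hνi using fun x => (hΦ x).exists_measure (hca x)
  have hunif := fun f (hf : Bdd f) (ε : ℝ) (hε : 0 < ε) => h.eventually_uniform hV hl hΦ hf hε
  have hmeas : ∀ f, Bdd f → Measurable fun x => Φ x f := by
    intro f hf
    choose n hn using fun k : ℕ => (hunif f hf (1 / ((k : ℝ) + 1)) (by positivity)).exists
    refine measurable_of_tendsto_metrizable (f := fun k => act (κ ^ n k) f)
      (fun k => (hf.act _).1) (tendsto_pi_nhds.2 fun x => ?_)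
    rw [tendsto_iff_dist_tendsto_zero]
    exact squeeze_zero (fun _ => dist_nonneg) (fun k => hn k x) tendsto_one_div_add_atTop_nhds_zero_nat
  let L : Kernel X X := ⟨ν, Measure.measurable_of_measurable_coe _ fun E hE => by
    have : (fun x => ν x E) = fun x => ENNReal.ofReal (Φ x (E.indicator 1)) := by
      funext x
      rw [← hνi x _ (Bdd.indicator hE), integral_indicator_one hE, ofReal_measureReal]
    rw [this]
    exact (hmeas _ (Bdd.indicator hE)).ennreal_ofReal⟩
  refine ⟨L, ⟨hν⟩, fun f hf ε hε => ?_⟩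
  filter_upwards [hunif f hf ε hε] with n hn x
  rw [show act L f x = Φ x f from hνi x f hf]
  exact hn x

theorem kernel_ext_act {κ η : Kernel X X} [IsMarkovKernel κ] [IsMarkovKernel η]
    (h : ∀ f, Bdd f → ∀ x, act κ f x = act η f x) : κ = η := by
  refine Kernel.ext fun x => Measure.ext fun E hE => ?_
  have := h _ (Bdd.indicator hE) x
  rw [act_indicator _ hE, act_indicator _ hE] at this
  rw [← ofReal_measureReal (μ := κ x), ← ofReal_measureReal (μ := η x), this]

theorem eq_of_forall_abs_sub_le {a b : ℝ} (C : ℝ) (h : ∀ ε > 0, |a - b| ≤ C * ε) : a = b := by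
  by_contra hne
  have h0 : 0 < |a - b| := abs_pos.2 (sub_ne_zero.2 hne)
  have h1 := h (|a - b| / (2 * (|C| + 1))) (by positivity)
  have h2 : C * (|a - b| / (2 * (|C| + 1))) ≤ (|C| + 1) * (|a - b| / (2 * (|C| + 1))) :=
    mul_le_mul_of_nonneg_right ((le_abs_self C).trans (by linarith)) (by positivity)
  have h3 : (|C| + 1) * (|a - b| / (2 * (|C| + 1))) = |a - b| / 2 := by
    field_simp
  linarith

theorem abs_act_sub_act_le (κ : Kernel X X) [IsMarkovKernel κ] {f g : X → ℝ} (hf : Bdd f)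
    (hg : Bdd g) {C : ℝ} (h : ∀ x, |f x - g x| ≤ C) (x : X) : |act κ f x - act κ g x| ≤ C :=
  (isMean_act κ x).dist_le hf hg h

attribute [local instance] Ultrafilter.add Ultrafilter.addSemigroup

/-- The Ellis–Numakura lemma. In `ℕ+` no element satisfies `a + a = a`, so an idempotent ultrafilter
is not principal and tends to infinity; in `ℕ` the principal ultrafilter at `0` would intervene. -/
theorem exists_idempotent_ultrafilter_pnat :
    ∃ U : Ultrafilter ℕ+, U + U = U ∧ ∀ N : ℕ, ∀ᶠ n : ℕ+ in (U : Filter ℕ+), N ≤ (n : ℕ) := by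
  obtain ⟨U, hU⟩ := exists_idempotent_of_compact_t2_of_continuous_add_left
    (M := Ultrafilter ℕ+) Ultrafilter.continuous_add_left
  refine ⟨U, hU, fun N => ?_⟩
  by_contra hN
  rw [← Ultrafilter.eventually_not] at hN
  have hfin : {n : ℕ+ | ¬ N ≤ (n : ℕ)}.Finite :=
    ((Set.finite_lt_nat N).preimage PNat.coe_injective.injOn).subset fun n hn => not_le.1 hn
  obtain ⟨a, _, rfl⟩ := U.eq_pure_of_finite_mem hfin hN
  have h1 : ∀ᶠ n in ((pure a + pure a : Ultrafilter ℕ+) : Filter ℕ+), n = a := by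
    rw [hU]
    exact mem_pure.2 rfl
  rw [Ultrafilter.eventually_add] at h1
  have h2 : a + a = a := by simpa using h1
  have h3 := congrArg PNat.val h2
  have h4 := a.pos
  simp only [PNat.add_coe] at h3
  omega

/-- A limit of powers of `κ` that is idempotent, with the inverse `R` of `κ` on its range. -/
structure IsAsymptotic (κ E R : Kernel X X) : Prop where
  idem : E ∘ₖ E = E
  comp_inv : κ ∘ₖ R = E
  inv_comp : R ∘ₖ κ = E
  approx : ∀ f, Bdd f → ∀ ε > 0, ∃ᶠ n in atTop, ∀ x, |act (κ ^ n) f x - act E f x| ≤ ε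

/-- `E` is the limit of `κ ^ n` and `R` that of `κ ^ (n - 1)` along the same `U`, whence both
composition identities. -/
theorem UniformCesaro.exists_isAsymptotic {κ : Kernel X X} [IsMarkovKernel κ] {m : Measure X}
    [IsProbabilityMeasure m] (h : UniformCesaro κ m) :
    ∃ E R : Kernel X X, IsMarkovKernel E ∧ IsMarkovKernel R ∧ IsAsymptotic κ E R := by
  obtain ⟨U, hU, hUt⟩ := exists_idempotent_ultrafilter_pnat
  have ht : Tendsto (fun n : ℕ+ => (n : ℕ)) U atTop := tendsto_atTop.2 hUt
  have ht' : Tendsto PNat.natPred U atTop := tendsto_atTop.2 fun N => by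
    filter_upwards [hUt (N + 1)] with n hn
    have := PNat.natPred_add_one n
    omega
  obtain ⟨E, hE, hEl⟩ := h.exists_limitKernel (V := U.map (fun n : ℕ+ => (n : ℕ))) ht
  obtain ⟨R, hR, hRl⟩ := h.exists_limitKernel (V := U.map PNat.natPred) ht'
  have hE' : ∀ f, Bdd f → ∀ ε > 0, ∀ᶠ n : ℕ+ in U, ∀ x, |act (κ ^ (n : ℕ)) f x - act E f x| ≤ ε :=
    fun f hf ε hε => hEl f hf ε hε
  have hR' : ∀ f, Bdd f → ∀ ε > 0, ∀ᶠ n : ℕ+ in U, ∀ x, |act (κ ^ n.natPred) f x - act R f x| ≤ ε :=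
    fun f hf ε hε => hRl f hf ε hε
  refine ⟨E, R, hE, hR, ⟨?_, ?_, ?_, ?_⟩⟩
  · refine kernel_ext_act fun f hf x => ?_
    rw [act_comp _ _ hf]
    refine eq_of_forall_abs_sub_le 3 fun ε hε => ?_
    have h1 := hE' f hf ε hε
    -- `U + U = U` makes the iterated limit of `κ ^ (n + k)`, which is `E ∘ₖ E`, equal to the simple
    -- limit `E`.
    have h2 : ∀ᶠ n in U, ∀ᶠ k in U,
        ∀ x, |act (κ ^ ((n + k : ℕ+) : ℕ)) f x - act E f x| ≤ ε := by
      rw [← Ultrafilter.eventually_add U U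
        (fun n : ℕ+ => ∀ x, |act (κ ^ (n : ℕ)) f x - act E f x| ≤ ε), hU]
      exact h1
    obtain ⟨n, hn1, hn2⟩ := ((hE' _ (hf.act E) ε hε).and h2).exists
    obtain ⟨k, hk1, hk2⟩ := (h1.and hn2).exists
    have a1 := abs_le.1 (hn1 x)
    have a2 := abs_le.1 (hk2 x)
    have a3 := abs_le.1 (abs_act_sub_act_le (κ ^ (n : ℕ)) (hf.act _) (hf.act _) hk1 x)
    rw [PNat.add_coe, add_comm, act_pow_add κ _ _ hf] at a2
    rw [abs_le]
    constructor <;> linarith [a1.1, a1.2, a2.1, a2.2, a3.1, a3.2]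
  · refine kernel_ext_act fun f hf x => ?_
    rw [act_comp _ _ hf]
    refine eq_of_forall_abs_sub_le 2 fun ε hε => ?_
    obtain ⟨n, hn1, hn2⟩ := ((hE' f hf ε hε).and (hR' _ (hf.act κ) ε hε)).exists
    have a1 := abs_le.1 (hn1 x)
    have a2 := abs_le.1 (hn2 x)
    rw [← PNat.natPred_add_one n, add_comm, act_pow_add κ 1 _ hf, act_pow_one] at a1
    rw [abs_le]
    constructor <;> linarith [a1.1, a1.2, a2.1, a2.2]
  · refine kernel_ext_act fun f hf x => ?_
    rw [act_comp _ _ hf]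
    refine eq_of_forall_abs_sub_le 2 fun ε hε => ?_
    obtain ⟨n, hn1, hn2⟩ := ((hE' f hf ε hε).and (hR' f hf ε hε)).exists
    have a1 := abs_le.1 (hn1 x)
    have a2 := abs_le.1 (abs_act_sub_act_le κ (hf.act _) (hf.act _) hn2 x)
    rw [← PNat.natPred_add_one n, act_pow_add κ _ 1 hf, act_pow_one] at a1
    rw [abs_le]
    constructor <;> linarith [a1.1, a1.2, a2.1, a2.2]
  · intro f hf ε hε
    exact ht.frequently (hE' f hf ε hε).frequently

/-- `E` is approximated by powers beyond `N`, and further steps do not increase distances. This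
carries the finite net of `κ ^ N` over to `E`. -/
theorem IsAsymptotic.abs_sub_le {κ E R : Kernel X X} [IsMarkovKernel κ] [IsMarkovKernel E]
    (h : IsAsymptotic κ E R)
    {f g : X → ℝ} (hf : Bdd f) (hg : Bdd g) {N : ℕ} {C : ℝ}
    (hC : ∀ x, |act (κ ^ N) f x - act (κ ^ N) g x| ≤ C) (x : X) :
    |act E f x - act E g x| ≤ C := by
  refine le_of_forall_pos_le_add fun ε hε => ?_
  have hs := hf.sub hg
  obtain ⟨n, hn, hnN⟩ := ((h.approx _ hs ε hε).and_eventually (eventually_ge_atTop N)).exists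
  obtain ⟨k, rfl⟩ := Nat.exists_eq_add_of_le hnN
  have a1 := abs_le.1 (hn x)
  have a2 := abs_le.1 (abs_act_sub_act_le (κ ^ k) (hf.act _) (hg.act _) hC x)
  rw [← act_pow_add κ N k hf, ← act_pow_add κ N k hg] at a2
  have e1 := (isMean_act (κ ^ (N + k)) x).sub hf hg
  have e2 := (isMean_act E x).sub hf hg
  rw [e1, e2] at a1
  rw [abs_le]
  constructor <;> linarith [a1.1, a1.2, a2.1, a2.2]

theorem IsAsymptotic.integral_act {κ E R : Kernel X X} [IsMarkovKernel κ] [IsMarkovKernel E]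
    (h : IsAsymptotic κ E R) {m : Measure X} [IsProbabilityMeasure m] (hm : UniformCesaro κ m)
    {f : X → ℝ} (hf : Bdd f) : ∫ x, act E f x ∂m = ∫ x, f x ∂m := by
  refine eq_of_forall_abs_sub_le 1 fun ε hε => ?_
  obtain ⟨n, hn⟩ := (h.approx f hf ε hε).exists
  have := (isMean_integral m).dist_le (hf.act _) (hf.act _) hn
  simp only [hm.inv_pow n hf] at this
  rwa [one_mul, abs_sub_comm]

/-! ### The lattice of fixed measures. -/

theorem integral_comp_measure (κ : Kernel X X) [IsMarkovKernel κ] (ν : Measure X)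
    [IsProbabilityMeasure ν] {f : X → ℝ} (hf : Bdd f) :
    ∫ x, f x ∂(κ ∘ₘ ν) = ∫ x, act κ f x ∂ν := by
  have h := Kernel.integral_comp (η := κ) (κ := Kernel.const Unit ν) (a := ()) (hf.integrable _)
  rw [Measure.comp_eq_comp_const_apply, h]
  rfl

theorem comp_mono (κ : Kernel X X) {ν ν' : Measure X} (h : ν ≤ ν') : κ ∘ₘ ν ≤ κ ∘ₘ ν' := by
  refine Measure.le_iff.2 fun s hs => ?_
  rw [Measure.bind_apply hs κ.aemeasurable, Measure.bind_apply hs κ.aemeasurable]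
  exact lintegral_mono' h le_rfl

theorem isFiniteMeasure_inf (ν ν' : Measure X) [IsFiniteMeasure ν] : IsFiniteMeasure (ν ⊓ ν') :=
  isFiniteMeasure_of_le ν inf_le_left

/-- By monotonicity the image of the infimum lies below both measures, hence below the infimum;
equal total masses force equality. The same mass argument handles differences. -/
theorem comp_inf_eq {E : Kernel X X} [IsMarkovKernel E] {ν ν' : Measure X} [IsFiniteMeasure ν]
    (h : E ∘ₘ ν = ν) (h' : E ∘ₘ ν' = ν') : E ∘ₘ (ν ⊓ ν') = ν ⊓ ν' := by
  have := isFiniteMeasure_inf ν ν'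
  refine Measure.eq_of_le_of_measure_univ_eq (le_inf ?_ ?_) Measure.comp_apply_univ
  · exact (comp_mono E inf_le_left).trans h.le
  · exact (comp_mono E inf_le_right).trans h'.le

theorem comp_sub_eq {E : Kernel X X} [IsMarkovKernel E] {ν ρ : Measure X} [IsFiniteMeasure ν]
    (h : E ∘ₘ ν = ν) (h' : E ∘ₘ ρ = ρ) (hle : ρ ≤ ν) : E ∘ₘ (ν - ρ) = ν - ρ := by
  have := isFiniteMeasure_of_le ν hle
  refine (Measure.eq_of_le_of_measure_univ_eq (Measure.sub_le_of_le_add ?_)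
    Measure.comp_apply_univ.symm).symm
  have e := congrArg (fun x : Measure X => E ∘ₘ x) (Measure.sub_add_cancel_of_le hle)
  simp only [Measure.comp_add, h, h'] at e
  exact e.ge

/-- A common minorant of the two remainders could be added to the infimum, so by finiteness it is
zero. -/
theorem disjoint_sub_inf (ν ν' : Measure X) [IsFiniteMeasure ν] :
    Disjoint (ν - ν ⊓ ν') (ν' - ν ⊓ ν') := by
  have := isFiniteMeasure_inf ν ν'
  intro c h1 h2
  have h3 : c + ν ⊓ ν' ≤ ν ⊓ ν' := by
    refine le_inf ?_ ?_
    · conv_rhs => rw [← Measure.sub_add_cancel_of_le (inf_le_left (a := ν) (b := ν'))]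
      gcongr
    · conv_rhs => rw [← Measure.sub_add_cancel_of_le (inf_le_right (a := ν) (b := ν'))]
      gcongr
  refine Measure.le_iff.2 fun s _ => ?_
  have h4 := h3 s
  rw [Measure.add_apply] at h4
  have h5 : c s + (ν ⊓ ν') s ≤ 0 + (ν ⊓ ν') s := by rwa [zero_add]
  exact (ENNReal.add_le_add_iff_right (measure_ne_top _ _)).1 h5

/-- Probability measures fixed by the kernel `E`. -/
def IsFixed (E : Kernel X X) (ν : Measure X) : Prop := IsProbabilityMeasure ν ∧ E ∘ₘ ν = ν

theorem exists_isFixed_ac {E : Kernel X X} {a : Measure X} [IsFiniteMeasure a] (h0 : a ≠ 0)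
    (ha : E ∘ₘ a = a) : ∃ b, IsFixed E b ∧ b ≪ a := by
  have hu : a Set.univ ≠ 0 := by simpa using h0
  refine ⟨(a Set.univ)⁻¹ • a, ⟨⟨?_⟩, by rw [Measure.comp_smul, ha]⟩,
    Measure.smul_absolutelyContinuous⟩
  rw [Measure.smul_apply, smul_eq_mul, ENNReal.inv_mul_cancel hu (measure_ne_top _ _)]

/-- Two distinct fixed probability measures dominate two mutually singular ones. -/
theorem IsFixed.exists_mutuallySingular {E : Kernel X X} [IsMarkovKernel E] {ν ν' : Measure X}
    (h : IsFixed E ν) (h' : IsFixed E ν') (hne : ν ≠ ν') :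
    ∃ a b, IsFixed E a ∧ IsFixed E b ∧ a ≪ ν ∧ b ≪ ν' ∧ a ⟂ₘ b := by
  obtain ⟨hp, h⟩ := h
  obtain ⟨hp', h'⟩ := h'
  have := isFiniteMeasure_inf ν ν'
  have hi := comp_inf_eq h h'
  -- Neither remainder vanishes, since one probability measure below another is equal to it.
  have key : ∀ {α β : Measure X}, IsProbabilityMeasure α → IsProbabilityMeasure β → α ≠ β →
      α ⊓ β = ν ⊓ ν' → α - ν ⊓ ν' ≠ 0 := by
    intro α β _ _ hαβ he h0
    have h1 := Measure.sub_add_cancel_of_le (show ν ⊓ ν' ≤ α from he ▸ inf_le_left)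
    rw [h0, zero_add, ← he] at h1
    exact hαβ (Measure.eq_of_le_of_isProbabilityMeasure (inf_eq_left.1 h1))
  obtain ⟨a, haf, ha⟩ := exists_isFixed_ac (key hp hp' hne rfl) (comp_sub_eq h hi inf_le_left)
  obtain ⟨b, hbf, hb⟩ := exists_isFixed_ac (key hp' hp hne.symm (inf_comm _ _))
    (comp_sub_eq h' hi inf_le_right)
  exact ⟨a, b, haf, hbf, ha.trans (Measure.absolutelyContinuous_of_le Measure.sub_le),
    hb.trans (Measure.absolutelyContinuous_of_le Measure.sub_le),
    (Measure.mutuallySingular_of_disjoint (disjoint_sub_inf ν ν')).mono_ac ha hb⟩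

/-! ### Finiteness and periodicity of the singular families. -/

/-- Finite families of mutually singular fixed probability measures. -/
def IsSingularFamily (E : Kernel X X) (T : Finset (Measure X)) : Prop :=
  (∀ τ ∈ T, IsFixed E τ) ∧ ∀ τ ∈ T, ∀ τ' ∈ T, τ ≠ τ' → τ ⟂ₘ τ'

theorem IsFixed.not_mutuallySingular_self {E : Kernel X X} {ν : Measure X} (h : IsFixed E ν) :
    ¬ ν ⟂ₘ ν := fun hs => by
  have := h.1
  exact IsProbabilityMeasure.ne_zero ν ((Measure.MutuallySingular.self_iff ν).1 hs)

theorem IsSingularFamily.insert [DecidableEq (Measure X)] {E : Kernel X X} {T : Finset (Measure X)}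
    (h : IsSingularFamily E T) {a : Measure X} (ha : IsFixed E a) (hs : ∀ τ ∈ T, a ⟂ₘ τ) :
    IsSingularFamily E (insert a T) ∧ (insert a T).card = T.card + 1 := by
  refine ⟨⟨fun τ hτ => ?_, fun τ hτ τ' hτ' hne => ?_⟩, Finset.card_insert_of_notMem fun hmem =>
    ha.not_mutuallySingular_self (hs a hmem)⟩
  · rcases Finset.mem_insert.1 hτ with rfl | hτ
    exacts [ha, h.1 τ hτ]
  · rcases Finset.mem_insert.1 hτ with h1 | h1 <;> rcases Finset.mem_insert.1 hτ' with h2 | h2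
    · exact absurd (h1.trans h2.symm) hne
    · exact h1 ▸ hs _ h2
    · exact h2 ▸ (hs _ h1).symm
    · exact h.2 τ h1 τ' h2 hne

theorem IsSingularFamily.erase [DecidableEq (Measure X)] {E : Kernel X X} {T : Finset (Measure X)}
    (h : IsSingularFamily E T) (a : Measure X) : IsSingularFamily E (T.erase a) :=
  ⟨fun τ hτ => h.1 τ (Finset.mem_of_mem_erase hτ), fun τ hτ τ' hτ' =>
    h.2 τ (Finset.mem_of_mem_erase hτ) τ' (Finset.mem_of_mem_erase hτ')⟩

/-- Quasi-compactness bounds the size of the mutually singular families. -/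
theorem IsAsymptotic.exists_card_le {κ E R : Kernel X X} [IsMarkovKernel κ] [IsMarkovKernel E]
    (hE : IsAsymptotic κ E R) {m : Measure X} [IsProbabilityMeasure m] (h : UniformCesaro κ m) :
    ∃ M : ℕ, ∀ T, IsSingularFamily E T → T.card ≤ M := by
  classical
  obtain ⟨N, s, hs⟩ := h.exists_net (show (0 : ℝ) < 1 / 4 by norm_num)
  choose! c hc hcs using hs
  refine ⟨s.card, fun T hT => ?_⟩
  -- `F τ` is null for `τ` and carries all the other members of `T`.
  have hset : ∀ τ, ∃ F : Set X, MeasurableSet F ∧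
      (τ ∈ T → τ F = 0 ∧ ∀ τ' ∈ T, τ ≠ τ' → τ' Fᶜ = 0) := by
    intro τ
    by_cases hτ : τ ∈ T
    · have hsg : ∀ τ', ∃ F, MeasurableSet F ∧ (τ' ∈ T → τ ≠ τ' → τ F = 0 ∧ τ' Fᶜ = 0) := by
        intro τ'
        by_cases h : τ' ∈ T ∧ τ ≠ τ'
        · obtain ⟨F, hF, h1, h2⟩ := hT.2 τ hτ τ' h.1 h.2
          exact ⟨F, hF, fun _ _ => ⟨h1, h2⟩⟩
        · exact ⟨∅, MeasurableSet.empty, fun h1 h2 => absurd ⟨h1, h2⟩ h⟩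
      choose G hG hG' using hsg
      refine ⟨⋃ τ' ∈ T.erase τ, G τ', Finset.measurableSet_biUnion _ fun τ' _ => hG τ',
        fun _ => ⟨?_, fun τ' hτ' hne => ?_⟩⟩
      · refine (measure_biUnion_null_iff (Finset.countable_toSet _)).2 fun τ' hτ' => ?_
        have hτ' := Finset.mem_erase.1 (Finset.mem_coe.1 hτ')
        exact (hG' τ' hτ'.2 hτ'.1.symm).1
      · refine measure_mono_null (Set.compl_subset_compl.2 ?_) (hG' τ' hτ' hne).2
        exact Set.subset_biUnion_of_mem (u := G)
          (Finset.mem_coe.2 (Finset.mem_erase.2 ⟨hne.symm, hτ'⟩))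
    · exact ⟨∅, MeasurableSet.empty, fun h => absurd h hτ⟩
  choose F hF hF' using hset
  -- If `F τ` and `F τ'` shared a centre of the net, the images under `E` of their indicators would
  -- differ by at most `1 / 4 + 1 / 4`; but their integrals against `τ` are `0` and `1`.
  refine Finset.card_le_card_of_injOn (fun τ => c ((F τ).indicator 1))
    (fun τ _ => hc _ (UnitBdd.indicator (hF τ))) fun τ hτ τ' hτ' heq => ?_
  by_contra hne
  have hτT := Finset.mem_coe.1 hτ
  have hτT' := Finset.mem_coe.1 hτ'
  have u := UnitBdd.indicator (X := X) (hF τ)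
  have u' := UnitBdd.indicator (X := X) (hF τ')
  have hclose : ∀ x, |act (κ ^ N) ((F τ).indicator 1) x - act (κ ^ N) ((F τ').indicator 1) x| ≤
      1 / 2 := by
    intro x
    have h1 := abs_le.1 (hcs _ u x)
    have h2 := abs_le.1 (hcs _ u' x)
    simp only at heq
    rw [heq] at h1
    rw [abs_le]
    constructor <;> linarith [h1.1, h1.2, h2.1, h2.2]
  have hEc := hE.abs_sub_le u.bdd u'.bdd hclose
  obtain ⟨hp, hfix⟩ := hT.1 τ hτT
  have h3 := (isMean_integral τ).dist_le (u.bdd.act E) (u'.bdd.act E) hEc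
  have e1 : ∫ x, act E ((F τ).indicator 1) x ∂τ = 0 := by
    rw [← integral_comp_measure E τ u.bdd, hfix, integral_indicator_one (hF τ), measureReal_def,
      (hF' τ hτT).1, ENNReal.toReal_zero]
  have e2 : ∫ x, act E ((F τ').indicator 1) x ∂τ = 1 := by
    have := prob_add_prob_compl (μ := τ) (hF τ')
    rw [(hF' τ' hτT').2 τ hτT (Ne.symm hne), add_zero] at this
    rw [← integral_comp_measure E τ u'.bdd, hfix, integral_indicator_one (hF τ'), measureReal_def,
      this, ENNReal.toReal_one]
  simp only [e1, e2] at h3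
  norm_num at h3

/-- A singular family of maximal size. -/
structure IsMaxFamily (E : Kernel X X) (T : Finset (Measure X)) : Prop where
  family : IsSingularFamily E T
  card_le : ∀ T', IsSingularFamily E T' → T'.card ≤ T.card

theorem exists_isMaxFamily {E : Kernel X X} {M : ℕ}
    (hM : ∀ T, IsSingularFamily E T → T.card ≤ M) : ∃ T, IsMaxFamily E T := by
  obtain ⟨T, hT, hc⟩ := Nat.sSup_mem (s := {k | ∃ T, IsSingularFamily E T ∧ T.card = k})
    ⟨0, ∅, ⟨by simp, by simp⟩, rfl⟩ ⟨M, by rintro _ ⟨T, hT, rfl⟩; exact hM T hT⟩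
  refine ⟨T, hT, fun T' hT' => ?_⟩
  rw [hc]
  exact le_csSup ⟨M, by rintro _ ⟨T, hT, rfl⟩; exact hM T hT⟩ ⟨T', hT', rfl⟩

/-- The members of a maximal family are atoms. -/
theorem IsMaxFamily.eq_of_ac {E : Kernel X X} [IsMarkovKernel E] {T : Finset (Measure X)}
    (hT : IsMaxFamily E T) {τ ρ : Measure X} (hτ : τ ∈ T) (hρ : IsFixed E ρ) (hac : ρ ≪ τ) :
    ρ = τ := by
  classical
  by_contra hne
  -- Replacing `τ` by the two singular measures `a` and `b` below it would enlarge the family.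
  obtain ⟨a, b, ha, hb, haρ, hbτ, hab⟩ := hρ.exists_mutuallySingular (hT.family.1 τ hτ) hne
  have hsing : ∀ c, c ≪ τ → ∀ τ' ∈ T.erase τ, c ⟂ₘ τ' := fun c hc τ' hτ' => by
    obtain ⟨h1, h2⟩ := Finset.mem_erase.1 hτ'
    exact (hT.family.2 τ hτ τ' h2 h1.symm).mono_ac hc Measure.AbsolutelyContinuous.rfl
  obtain ⟨h1, h2⟩ := (hT.family.erase τ).insert hb (hsing b hbτ)
  obtain ⟨h3, h4⟩ := h1.insert ha fun τ' hτ' => by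
    rcases Finset.mem_insert.1 hτ' with rfl | hτ'
    · exact hab
    · exact hsing a (haρ.trans hac) τ' hτ'
  have h5 := hT.card_le _ h3
  rw [h4, h2] at h5
  have := Finset.card_erase_add_one hτ
  omega

/-- `κ` commutes with `E`, because `E κ = κ R κ = κ E`. -/
theorem IsAsymptotic.isFixed_comp {κ E R : Kernel X X} [IsMarkovKernel κ] (h : IsAsymptotic κ E R)
    {ν : Measure X} (hν : IsFixed E ν) : IsFixed E (κ ∘ₘ ν) := by
  obtain ⟨hp, hν⟩ := hν
  refine ⟨inferInstance, ?_⟩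
  rw [Measure.comp_assoc, ← h.comp_inv, Kernel.comp_assoc, h.inv_comp, ← Measure.comp_assoc, hν]

theorem IsAsymptotic.isFixed_comp_inv {κ E R : Kernel X X} [IsMarkovKernel R]
    (h : IsAsymptotic κ E R) {ν : Measure X} (hν : IsFixed E ν) : IsFixed E (R ∘ₘ ν) := by
  obtain ⟨hp, hν⟩ := hν
  refine ⟨inferInstance, ?_⟩
  rw [Measure.comp_assoc, ← h.inv_comp, Kernel.comp_assoc, h.comp_inv, ← Measure.comp_assoc, hν]

/-- By maximality `κ ∘ₘ τ` overlaps some `τ'` in `T`. The normalized common part `ρ` is `τ'`, as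
`τ'` is an atom, and `R ∘ₘ ρ ≪ τ` gives `R ∘ₘ ρ = τ`. Applying `κ` yields `κ ∘ₘ τ = ρ = τ'`. -/
theorem IsAsymptotic.comp_mem {κ E R : Kernel X X} [IsMarkovKernel κ] [IsMarkovKernel E]
    [IsMarkovKernel R] (h : IsAsymptotic κ E R) {T : Finset (Measure X)} (hT : IsMaxFamily E T)
    {τ : Measure X} (hτ : τ ∈ T) : κ ∘ₘ τ ∈ T := by
  classical
  have hτf := hT.family.1 τ hτ
  have hσ := h.isFixed_comp hτf
  obtain ⟨τ', hτ', hns⟩ : ∃ τ' ∈ T, ¬ (κ ∘ₘ τ) ⟂ₘ τ' := by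
    by_contra! hcon
    obtain ⟨h1, h2⟩ := hT.family.insert hσ hcon
    have := hT.card_le _ h1
    omega
  have hτ'f := hT.family.1 τ' hτ'
  have := hσ.1
  have := isFiniteMeasure_inf (κ ∘ₘ τ) τ'
  have h0 : (κ ∘ₘ τ) ⊓ τ' ≠ 0 := fun h0 =>
    hns (Measure.mutuallySingular_of_disjoint (disjoint_iff.2 h0))
  obtain ⟨ρ, hρ, hac⟩ := exists_isFixed_ac h0 (comp_inf_eq hσ.2 hτ'f.2)
  have e1 : ρ = τ' := hT.eq_of_ac hτ' hρ
    (hac.trans (Measure.absolutelyContinuous_of_le inf_le_right))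
  have e2 : R ∘ₘ ρ = τ := by
    refine hT.eq_of_ac hτ (h.isFixed_comp_inv hρ) ?_
    have h1 := (hac.trans (Measure.absolutelyContinuous_of_le inf_le_left)).comp_right R
    rwa [Measure.comp_assoc, h.inv_comp, hτf.2] at h1
  have e3 : κ ∘ₘ τ = ρ := by rw [← e2, Measure.comp_assoc, h.comp_inv, hρ.2]
  rw [e3, e1]
  exact hτ'

/-- On the finite set `T` the map is injective, with left inverse `R`, and every point of an
injective self-map of a finite set is periodic. -/
theorem IsAsymptotic.exists_isPeriodicPt {κ E R : Kernel X X} [IsMarkovKernel κ] [IsMarkovKernel E]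
    [IsMarkovKernel R] (h : IsAsymptotic κ E R) {T : Finset (Measure X)} (hT : IsMaxFamily E T)
    {τ : Measure X} (hτ : τ ∈ T) : τ ∈ Function.periodicPts fun ν : Measure X => κ ∘ₘ ν := by
  let φ : T → T := fun τ => ⟨κ ∘ₘ τ.1, h.comp_mem hT τ.2⟩
  have hφ : Function.Injective φ := by
    intro a b hab
    have h1 : κ ∘ₘ a.1 = κ ∘ₘ b.1 := congrArg Subtype.val hab
    have h2 := congrArg (fun ν : Measure X => R ∘ₘ ν) h1
    simp only [Measure.comp_assoc, h.inv_comp] at h2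
    rw [(hT.family.1 a.1 a.2).2, (hT.family.1 b.1 b.2).2] at h2
    exact Subtype.ext h2
  obtain ⟨n, hn, hp⟩ := hφ.mem_periodicPts ⟨τ, hτ⟩
  exact ⟨n, hn, hp.map (g := Subtype.val) fun _ => rfl⟩

/-! ### Convergence of the powers for a simple invariant measure. -/

/-- Without periodic measures, the powers of the kernel converge. -/
theorem UniformCesaro.tendsto_of_aperiodic {κ : Kernel X X} [IsMarkovKernel κ] {m : Measure X}
    [IsProbabilityMeasure m] (h : UniformCesaro κ m)
    (huniq : ∀ ν : Measure X, IsProbabilityMeasure ν →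
      ν ∈ Function.periodicPts (fun ν : Measure X => κ ∘ₘ ν) → ν = m)
    {f : X → ℝ} (hf : Bdd f) {ε : ℝ} (hε : 0 < ε) :
    ∃ N : ℕ, ∀ n ≥ N, ∀ x, |act (κ ^ n) f x - ∫ x, f x ∂m| ≤ ε := by
  classical
  obtain ⟨E, R, _, _, hE⟩ := h.exists_isAsymptotic
  obtain ⟨M, hM⟩ := hE.exists_card_le h
  obtain ⟨T, hT⟩ := exists_isMaxFamily hM
  have hm : IsFixed E m := by
    refine ⟨inferInstance, Measure.ext fun F hF => ?_⟩
    have h1 := hE.integral_act h (Bdd.indicator hF)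
    rw [← integral_comp_measure E m (Bdd.indicator hF), integral_indicator_one hF,
      integral_indicator_one hF] at h1
    rw [← ofReal_measureReal (μ := E ∘ₘ m), ← ofReal_measureReal (μ := m), h1]
  -- A second fixed measure would yield a singular pair, so `T` would have two distinct members,
  -- both periodic and hence both equal to `m`.
  have huniqE : ∀ ν, IsFixed E ν → ν = m := by
    intro ν hν
    by_contra hne
    obtain ⟨a, b, ha, hb, _, _, hab⟩ := hν.exists_mutuallySingular hm hne
    have hempty : IsSingularFamily E (∅ : Finset (Measure X)) := ⟨by simp, by simp⟩
    obtain ⟨h1, h2⟩ := hempty.insert hb (by simp)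
    obtain ⟨h3, h4⟩ := h1.insert ha (by simpa using hab)
    have h5 := hT.card_le _ h3
    rw [h4, h2, Finset.card_empty] at h5
    obtain ⟨τ, hτ, τ', hτ', hne'⟩ := Finset.one_lt_card.1 (show 1 < T.card by omega)
    exact hne' ((huniq τ (hT.family.1 τ hτ).1 (hE.exists_isPeriodicPt hT hτ)).trans
      (huniq τ' (hT.family.1 τ' hτ').1 (hE.exists_isPeriodicPt hT hτ')).symm)
  -- Idempotence says that each `E x` is itself fixed by `E`.
  have hEx : ∀ x, E x = m := fun x => huniqE _ ⟨inferInstance, by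
    rw [← Kernel.comp_apply, hE.idem]⟩
  obtain ⟨N, hN⟩ := (hE.approx f hf ε hε).exists
  refine ⟨N, fun n hn x => ?_⟩
  obtain ⟨k, rfl⟩ := Nat.exists_eq_add_of_le hn
  rw [act_pow_add κ N k hf]
  have h1 : ∀ y, |act (κ ^ N) f y - ∫ x, f x ∂m| ≤ ε := fun y => by
    have h2 := hN y
    have h3 : act E f y = ∫ x, f x ∂m := by rw [act, hEx]
    rwa [h3] at h2
  have h2 := (isMean_act (κ ^ k) x).dist_le (hf.act _) (Bdd.const (∫ x, f x ∂m)) h1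
  rwa [(isMean_act (κ ^ k) x).const] at h2

theorem markovOp_ofMeasure (κ : Kernel X X) [IsMarkovKernel κ] (ν : Measure X)
    [IsProbabilityMeasure ν] : markovOp κ (ofMeasure ν) = ofMeasure (κ ∘ₘ ν) := by
  rw [markovOp_eq, ofMeasure_eq (κ ∘ₘ ν)]
  funext E
  have hb := Bdd.indicator E.2
  simp only [toSetFun]
  rw [faIntegral_ofMeasure ν (hb.act κ), integral_comp_measure κ ν hb]

theorem isProbabilityMeasure_iterate (κ : Kernel X X) [IsMarkovKernel κ] (ν : Measure X)
    [IsProbabilityMeasure ν] (n : ℕ) :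
    IsProbabilityMeasure ((fun ν : Measure X => κ ∘ₘ ν)^[n] ν) := by
  induction n with
  | zero => assumption
  | succ n ih =>
    rw [Function.iterate_succ_apply']
    infer_instance

theorem iterate_markovOp_ofMeasure (κ : Kernel X X) [IsMarkovKernel κ] (ν : Measure X)
    [IsProbabilityMeasure ν] (n : ℕ) :
    (markovOp κ)^[n] (ofMeasure ν) = ofMeasure ((fun ν : Measure X => κ ∘ₘ ν)^[n] ν) := by
  induction n with
  | zero => rfl
  | succ n ih =>
    have := isProbabilityMeasure_iterate κ ν n
    rw [Function.iterate_succ_apply', Function.iterate_succ_apply', ih, markovOp_ofMeasure]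

theorem ofMeasure_injective {ν ν' : Measure X} [IsFiniteMeasure ν] [IsFiniteMeasure ν']
    (h : ofMeasure ν = ofMeasure ν') : ν = ν' := by
  refine Measure.ext fun E hE => ?_
  have h1 : ν.real E = ν'.real E := congrFun h ⟨E, hE⟩
  rw [← ofReal_measureReal (μ := ν), ← ofReal_measureReal (μ := ν'), h1]

/-- The mean of the members of a cycle is invariant. -/
theorem IsCycle.mean_mem {κ : Kernel X X} [IsMarkovKernel κ] {n : ℕ} {ν : Fin n → SetFun X}
    (h : IsCycle κ n ν) : (1 / (n : ℝ)) • ∑ i, ν i ∈ Dba κ := by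
  obtain ⟨hn, _, hS, hstep⟩ := h
  have hne : (Finset.univ : Finset (Fin n)).Nonempty := ⟨⟨0, by omega⟩, Finset.mem_univ _⟩
  have hΦ := isMean_average hne (fun i _ => isMean_faIntegral (hS i))
  rw [Finset.card_univ, Fintype.card_fin] at hΦ
  have hmem := mem_Dba_of_act (κ := κ) hΦ fun f hf => by
    rw [← Equiv.sum_comp (finRotate n) fun i => faIntegral (ν i) f]
    simp only [← hstep, faIntegral_markovOp κ (hS _) hf]
  convert hmem using 1
  funext E
  simp only [toSetFun, Pi.smul_apply, Finset.sum_apply, smul_eq_mul]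
  exact congrArg _ (Finset.sum_congr rfl fun i _ => (faIntegral_indicator (hS i).1 E).symm)

/-- If the unique invariant mean is simple, it is the only periodic one. -/
theorem eq_of_mem_periodicPts {κ : Kernel X X} [IsMarkovKernel κ] {μ : SetFun X}
    (hμ : Dba κ = {μ}) (hs : ¬ IsComposite κ μ) {η : SetFun X} (hη : η ∈ Sba X)
    (hp : η ∈ Function.periodicPts (markovOp κ)) : η = μ := by
  have hpos := Function.minimalPeriod_pos_of_mem_periodicPts hp
  set p := Function.minimalPeriod (markovOp κ) η with hpdef
  -- Minimal period `1` means invariant. Otherwise the orbit is a cycle whose mean is invariant,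
  -- hence equal to `μ`, which is then composite.
  rcases Nat.eq_or_lt_of_le (Nat.succ_le_of_lt hpos) with h1 | h1
  · have h2 : markovOp κ η = η := Function.minimalPeriod_eq_one_iff_isFixedPt.1 (hpdef ▸ h1.symm)
    have h3 : η ∈ Dba κ := ⟨hη, h2⟩
    rwa [hμ] at h3
  · refine absurd ?_ hs
    have hcyc : IsCycle κ p fun i => (markovOp κ)^[i] η := by
      refine ⟨h1, fun i j hij => Fin.ext ?_, fun i => iterate_mem κ hη i, fun i => ?_⟩
      · exact Function.iterate_injOn_Iio_minimalPeriod i.2 j.2 hij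
      · obtain ⟨q, hq⟩ := Nat.exists_eq_succ_of_ne_zero hpos.ne'
        -- `finRotate` adds one modulo `p`; the exponent is reduced modulo the minimal period to
        -- match it at the last index.
        rw [← Function.iterate_succ_apply' (markovOp κ),
          ← Function.iterate_mod_minimalPeriod_eq (n := (i : ℕ).succ), ← hpdef]
        congr 2
        clear_value p
        subst hq
        rw [finRotate_apply, Fin.val_add, Fin.val_one']
        simp
    have h2 := hcyc.mean_mem
    rw [hμ] at h2
    exact ⟨p, _, hcyc, (Set.mem_singleton_iff.1 h2).symm⟩

theorem exists_uniformCesaro {κ : Kernel X X} [IsMarkovKernel κ] {μ : SetFun X}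
    (hμ : Dba κ = {μ}) :
    ∃ m : Measure X, IsProbabilityMeasure m ∧ ofMeasure m = μ ∧ UniformCesaro κ m := by
  have hμD : μ ∈ Dba κ := hμ.ge rfl
  obtain ⟨m, hm, hmE⟩ := exists_measure_of_mem_ca hμD.1 (invariant_mem_ca κ hμ)
  have he : ofMeasure m = μ := funext hmE
  have hint : ∀ f, Bdd f → faIntegral μ f = ∫ x, f x ∂m := fun f hf => by
    rw [← he, faIntegral_ofMeasure m hf]
  refine ⟨m, hm, he, fun f hf => ?_, fun f hf ε hε => ?_⟩
  · rw [← hint f hf, ← hint _ (hf.act κ), ← faIntegral_markovOp κ hμD.1 hf, hμD.2]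
  · rw [← hint f hf]
    exact cesaroAct_uniform κ hμ hf hε

theorem iterate_tendsto (κ : Kernel X X) [IsMarkovKernel κ] {μ : SetFun X} (hμ : Dba κ = {μ})
    (hs : ¬ IsComposite κ μ) {η : SetFun X} (hη : η ∈ Sba X) :
    TendstoTauB (fun n => (markovOp κ)^[n] η) μ ∧
      ∀ E : MSet X, Tendsto (fun n => (markovOp κ)^[n] η E) atTop (𝓝 (μ E)) := by
  obtain ⟨m, hm, rfl, hU⟩ := exists_uniformCesaro hμ
  refine tendsto_of_forall_faIntegral (ofMeasure_mem m) (.of_forall fun n => iterate_mem κ hη n)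
    fun f hf => ?_
  rw [Metric.tendsto_atTop]
  intro ε hε
  obtain ⟨N, hN⟩ := hU.tendsto_of_aperiodic (fun ν _ ⟨n, hn, hν⟩ => by
    refine ofMeasure_injective (eq_of_mem_periodicPts hμ hs (ofMeasure_mem ν) ⟨n, hn, ?_⟩)
    rw [Function.IsPeriodicPt, Function.IsFixedPt, iterate_markovOp_ofMeasure]
    exact congrArg ofMeasure hν) hf (half_pos hε)
  refine ⟨N, fun n hn => ?_⟩
  have h1 := (isMean_faIntegral hη).dist_le (hf.act (κ ^ n)) (Bdd.const (∫ x, f x ∂m)) (hN n hn)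
  rw [(isMean_faIntegral hη).const] at h1
  rw [faIntegral_iterate κ hη n hf, faIntegral_ofMeasure m hf, Real.dist_eq]
  exact h1.trans_lt (half_lt_self hε)

end FAMarkov

theorem theorem5p2 {X : Type*} [MeasurableSpace X]
    (κ : ProbabilityTheory.Kernel X X) [ProbabilityTheory.IsMarkovKernel κ]
    (μ : FAMarkov.SetFun X) (hμ : FAMarkov.Dba κ = {μ}) :
    FAMarkov.Dba κ ⊆ FAMarkov.ca X ∧
    (∀ η ∈ FAMarkov.Sba X,
      FAMarkov.TendstoTauB (FAMarkov.cesaro κ η) μ ∧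
      ∀ E : FAMarkov.MSet X, Tendsto (fun n => FAMarkov.cesaro κ η n E) atTop (𝓝 (μ E))) ∧
    (FAMarkov.IsSimpleInvariant κ μ →
      ∀ η ∈ FAMarkov.Sba X,
        FAMarkov.TendstoTauB (fun n => (FAMarkov.markovOp κ)^[n] η) μ ∧
        ∀ E : FAMarkov.MSet X,
          Tendsto (fun n => (FAMarkov.markovOp κ)^[n] η E) atTop (𝓝 (μ E))) := by
  refine ⟨?_, fun η hη => FAMarkov.cesaro_tendsto κ hμ hη,
    fun hs η hη => FAMarkov.iterate_tendsto κ hμ hs.2 hη⟩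
  rw [hμ, Set.singleton_subset_iff]
  exact FAMarkov.invariant_mem_ca κ hμ
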